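/- Let $\Bbbk$ be a field of characteristic $0$. Sumless Sweedler notation is used throughout. **Weak Hopf algebras and integrals.** A weak Hopf algebra over $\Bbbk$ is a unital associative $\Bbbk$-algebra $H$ which is also a $\Bbbk$-coalgebra $(H,\Delta,\varepsilon)$, such that for all $a,b,c\in H$ $$\Delta(ab)=\Delta(a)\Delta(b),\qquad \varepsilon(abc)=\varepsilon(ab_1)\varepsilon(b_2c)=\varepsilon(ab_2)\varepsilon(b_1c),$$ $$\Delta^2(1)=(\Delta(1)\otimes 1)(1\otimes\Delta(1))=(1\otimes\Delta(1))(\Delta(1)\otimes 1),$$ together with a linear map $S:H\to H$ satisfying $S(h_1)h_2=1_1\varepsilon(h1_2)$, $h_1S(h_2)=\varepsilon_t(h)$ and $S(h_1)h_2S(h_3)=S(h)$ for all $h\in H$, where $\varepsilon_t(h):=\varepsilon(1_1h)1_2$. An element $\Lambda\in H$ is a left integral if $h\Lambda=\varepsilon_t(h)\Lambda$ for all $h\in H$; it is non-degenerate if the linear map $\Psi_\Lambda:H^*\to H$, $\phi\mapsto\Lambda_1\phi(\Lambda_2)$, is bijective. **Data.** Let $L$ be a finite-dimensional Hopf algebra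 over $\Bbbk$ with comultiplication $\Delta_L$, counit $\varepsilon_L$ and antipode $S_L$ (which is then bijective). Let $B$ be a finite-dimensional (unital, associative) $\Bbbk$-algebra which is strongly separable, with symmetric separability idempotent $e^1\otimes e^2\in B\otimes B$, i.e. $$be^1\otimes e^2=e^1\otimes e^2b\ \ (b\in B),\qquad e^1e^2=1_B,\qquad e^1\otimes e^2=e^2\otimes e^1,$$ and let $\omega:B\to\Bbbk$ be the (unique) linear form with $\omega(e^1)e^2=1_B=e^1\omega(e^2)$. Let $\triangleleft:B\otimes L\to B$ make $B$ a right $L$-module algebra, i.e. $$(b\triangleleft\ell)\triangleleft\ell'=b\triangleleft(\ell\ell'),\quad b\triangleleft 1_L=b,\quad (bb')\triangleleft\ell=(b\triangleleft\ell_1)(b'\triangleleft\ell_2),\quad 1_B\triangleleft\ell=\varepsilon_L(\ell)1_B,$$ and assume that $(e^1\triangleleft\ell)\otimes e^2=e^1\otimes(e^2\triangleleft S_L(\ell))$ for all $\ell\in L$. **The quantum transformation groupoid.** Let $H(L,B)$ be the weak Hopf algebra with underlying vector space $B^{op}\otimes L\otimes B$, unit $1_B\otimes1_L\otimes1_B$,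 and $$(a\otimes\ell\otimes b)(a'\otimes\ell'\otimes b')=(a'\triangleleft S_L(\ell_1))a\otimes\ell_2\ell'_1\otimes(b\triangleleft\ell'_2)b',$$ $$\Delta(a\otimes\ell\otimes b)=(a\otimes\ell_1\otimes e^1)\otimes\big((e^2\triangleleft S_L(\ell_2))\otimes\ell_3\otimes b\big),$$ $$\varepsilon(a\otimes\ell\otimes b)=\omega\big(a(b\triangleleft S_L^{-1}(\ell))\big),\qquad S(a\otimes\ell\otimes b)=b\otimes S_L(\ell)\otimes a,$$ where all products of elements of $B$ are taken in $B$ (not in $B^{op}$). **Proposition.** Let $\Lambda\in L$ be a right integral of $L$, i.e. $\Lambda\ell=\varepsilon_L(\ell)\Lambda$ for all $\ell\in L$. Then $$\bar\Lambda:=(e^1\triangleleft\Lambda_1)\otimes S_L(\Lambda_2)\otimes e^2$$ is a left integral of $H(L,B)$, and if $\Lambda\neq0$ then $\bar\Lambda$ is non-degenerate. -/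

import Mathlib

open scoped TensorProduct
open Coalgebra HopfAlgebra

/-! ### Sweedler notation -/

attribute [fun_prop] IsLinearMap

/-- Sweedler notation. For `t = ∑ᵢ uᵢ ⊗ vᵢ`, written `t¹ ⊗ t²` without the sum, `sweedler f t` is
`f(t¹, t²) := ∑ᵢ f(uᵢ, vᵢ)`. It is only used for bilinear `f`, where it does not depend on the way
`t` is written as a sum of pure tensors (see `sweedler_eq_lift`). -/
noncomputable def sweedler {k U V M : Type*} [Field k] [AddCommGroup U] [Module k U]
    [AddCommGroup V] [Module k V] [AddCommGroup M] (f : U → V → M) (t : U ⊗[k] V) : M :=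
  ∑ p ∈ (TensorProduct.exists_finset t).choose, f p.1 p.2

set_option linter.unusedSectionVars false

namespace Sweedler

section General

variable {k U V W M N X A : Type*} [Field k] [AddCommGroup U] [Module k U]
  [AddCommGroup V] [Module k V] [AddCommGroup W] [Module k W] [AddCommGroup M] [Module k M]
  [AddCommGroup N] [Module k N] [AddCommGroup X] [Module k X] [Ring A] [Algebra k A]

@[fun_prop] theorem lin_id : IsLinearMap k (fun x : U => x) := ⟨fun _ _ => rfl, fun _ _ => rfl⟩

@[fun_prop] theorem lin_comp {f : V → W} {g : U → V} (hf : IsLinearMap k f)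
    (hg : IsLinearMap k g) : IsLinearMap k (fun x => f (g x)) :=
  ⟨fun x y => by rw [hg.map_add, hf.map_add], fun c x => by rw [hg.map_smul, hf.map_smul]⟩

@[fun_prop] theorem lin_lm (φ : V →ₗ[k] W) : IsLinearMap k (fun x => φ x) := φ.isLinear

@[fun_prop] theorem lin_app {g : U → V →ₗ[k] W} (hg : IsLinearMap k g) (v : V) :
    IsLinearMap k (fun x => g x v) :=
  ⟨fun x y => by rw [hg.map_add]; rfl, fun c x => by rw [hg.map_smul]; rfl⟩

@[fun_prop] theorem lin_mul_l {g : U → A} (hg : IsLinearMap k g) (v : A) :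
    IsLinearMap k (fun x => g x * v) :=
  ⟨fun x y => by rw [hg.map_add, add_mul], fun c x => by rw [hg.map_smul, smul_mul_assoc]⟩

@[fun_prop] theorem lin_mul_r {g : U → A} (hg : IsLinearMap k g) (v : A) :
    IsLinearMap k (fun x => v * g x) :=
  ⟨fun x y => by rw [hg.map_add, mul_add], fun c x => by rw [hg.map_smul, mul_smul_comm]⟩

@[fun_prop] theorem lin_smul_l {g : U → k} (hg : IsLinearMap k g) (v : M) :
    IsLinearMap k (fun x => g x • v) :=
  ⟨fun x y => by rw [hg.map_add, add_smul], fun c x => by rw [hg.map_smul, smul_assoc]⟩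

@[fun_prop] theorem lin_smul_r {g : U → M} (hg : IsLinearMap k g) (v : k) :
    IsLinearMap k (fun x => v • g x) :=
  ⟨fun x y => by rw [hg.map_add, smul_add], fun c x => by rw [hg.map_smul, smul_comm]⟩

@[fun_prop] theorem lin_tmul_l {g : U → M} (hg : IsLinearMap k g) (v : N) :
    IsLinearMap k (fun x => g x ⊗ₜ[k] v) :=
  ⟨fun x y => by rw [hg.map_add, TensorProduct.add_tmul],
    fun c x => by rw [hg.map_smul, TensorProduct.smul_tmul']⟩

@[fun_prop] theorem lin_tmul_r {g : U → M} (hg : IsLinearMap k g) (v : N) :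
    IsLinearMap k (fun x => v ⊗ₜ[k] g x) :=
  ⟨fun x y => by rw [hg.map_add, TensorProduct.tmul_add],
    fun c x => by rw [hg.map_smul, TensorProduct.tmul_smul]⟩

@[fun_prop] theorem lin_sweedler_f {f : X → U → V → M}
    (hf : ∀ u v, IsLinearMap k (fun x => f x u v)) (t : U ⊗[k] V) :
    IsLinearMap k (fun x => sweedler (f x) t) :=
  ⟨fun x y => by simp [sweedler, (hf _ _).map_add, Finset.sum_add_distrib],
    fun c x => by simp [sweedler, (hf _ _).map_smul, Finset.smul_sum]⟩

theorem sweedler_eq_lift {f : U → V → M} (h1 : ∀ v, IsLinearMap k (fun u => f u v))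
    (h2 : ∀ u, IsLinearMap k (fun v => f u v)) (t : U ⊗[k] V) :
    sweedler f t = TensorProduct.lift (LinearMap.mk₂ k f (fun _ _ v => (h1 v).map_add _ _)
      (fun _ _ v => (h1 v).map_smul _ _) (fun u => (h2 u).map_add)
      (fun _ u _ => (h2 u).map_smul _ _)) t := by
  conv_rhs => rw [(TensorProduct.exists_finset t).choose_spec]
  simp [sweedler]

@[fun_prop] theorem lin_sweedler_t {f : U → V → M} {g : X → U ⊗[k] V}
    (h1 : ∀ v, IsLinearMap k (fun u => f u v)) (h2 : ∀ u, IsLinearMap k (fun v => f u v))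
    (hg : IsLinearMap k g) : IsLinearMap k (fun x => sweedler f (g x)) := by
  simp only [sweedler_eq_lift h1 h2]; fun_prop

theorem sweedler_tmul {f : U → V → M} (h1 : ∀ v, IsLinearMap k (fun u => f u v))
    (h2 : ∀ u, IsLinearMap k (fun v => f u v)) (u : U) (v : V) :
    sweedler f (u ⊗ₜ[k] v) = f u v := by
  simp [sweedler_eq_lift h1 h2]

theorem map_sweedler {φ : M → N} (hφ : IsLinearMap k φ) (f : U → V → M) (t : U ⊗[k] V) :
    φ (sweedler f t) = sweedler (fun u v => φ (f u v)) t :=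
  map_sum hφ.mk' _ _

theorem lm_sweedler (φ : M →ₗ[k] N) (f : U → V → M) (t : U ⊗[k] V) :
    φ (sweedler f t) = sweedler (fun u v => φ (f u v)) t := map_sum φ _ _

theorem le_sweedler (φ : M ≃ₗ[k] N) (f : U → V → M) (t : U ⊗[k] V) :
    φ (sweedler f t) = sweedler (fun u v => φ (f u v)) t := map_sum φ _ _

theorem app_sweedler (f : U → V → M →ₗ[k] N) (t : U ⊗[k] V) (m : M) :
    (sweedler f t) m = sweedler (fun u v => f u v m) t := by
  simp [sweedler, LinearMap.sum_apply]

theorem sweedler_mul (f : U → V → A) (t : U ⊗[k] V) (a : A) :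
    sweedler f t * a = sweedler (fun u v => f u v * a) t := Finset.sum_mul ..

theorem mul_sweedler (f : U → V → A) (t : U ⊗[k] V) (a : A) :
    a * sweedler f t = sweedler (fun u v => a * f u v) t := Finset.mul_sum ..

theorem smul_sweedler (f : U → V → M) (t : U ⊗[k] V) (a : k) :
    a • sweedler f t = sweedler (fun u v => a • f u v) t := Finset.smul_sum

theorem sweedler_smul (f : U → V → k) (t : U ⊗[k] V) (a : M) :
    sweedler f t • a = sweedler (fun u v => f u v • a) t := Finset.sum_smul

theorem tmul_sweedler (f : U → V → M) (t : U ⊗[k] V) (a : N) :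
    a ⊗ₜ[k] sweedler f t = sweedler (fun u v => a ⊗ₜ[k] f u v) t := TensorProduct.tmul_sum ..

theorem sweedler_tmul' (f : U → V → M) (t : U ⊗[k] V) (a : N) :
    sweedler f t ⊗ₜ[k] a = sweedler (fun u v => f u v ⊗ₜ[k] a) t := TensorProduct.sum_tmul ..

theorem sweedler_self (t : U ⊗[k] V) : sweedler (fun u v => u ⊗ₜ[k] v) t = t :=
  (TensorProduct.exists_finset t).choose_spec.symm

theorem sweedler_comm {U' V' : Type*} [AddCommGroup U'] [Module k U'] [AddCommGroup V']
    [Module k V'] (f : U → V → U' → V' → M) (t : U ⊗[k] V) (s : U' ⊗[k] V') :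
    sweedler (fun a b => sweedler (fun c d => f a b c d) s) t =
      sweedler (fun c d => sweedler (fun a b => f a b c d) t) s :=
  Finset.sum_comm

/-- Apply a linear map to an identity between tensors. -/
theorem sweedler_sweedler {U' V' : Type*} [AddCommGroup U'] [Module k U'] [AddCommGroup V']
    [Module k V'] {f : U → V → M} (h1 : ∀ v, IsLinearMap k (fun u => f u v))
    (h2 : ∀ u, IsLinearMap k (fun v => f u v)) (g : U' → V' → U ⊗[k] V) (t : U' ⊗[k] V') :
    sweedler f (sweedler g t) = sweedler (fun a b => sweedler f (g a b)) t :=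
  map_sweedler (φ := fun t => sweedler f t) (by fun_prop) g t

end General

section Coalg

variable {k L M : Type*} [Field k] [AddCommGroup M] [Module k M]

section
variable [AddCommGroup L] [Module k L] [Coalgebra k L]

theorem sw_coassoc {f : L → L → L → M} (h1 : ∀ y z, IsLinearMap k (fun x => f x y z))
    (h2 : ∀ x z, IsLinearMap k (fun y => f x y z)) (h3 : ∀ x y, IsLinearMap k (fun z => f x y z))
    (ℓ : L) :
    sweedler (fun u z => sweedler (fun x y => f x y z) (comul (R := k) u)) (comul (R := k) ℓ) =
      sweedler (fun x v => sweedler (fun y z => f x y z) (comul (R := k) v))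
        (comul (R := k) ℓ) := by
  have key := congrArg (fun t => sweedler (fun x p => sweedler (fun y z => f x y z) p) t)
    (coassoc_apply (R := k) ℓ)
  rw [← sweedler_self (comul (R := k) ℓ)] at key
  simp only [lm_sweedler, le_sweedler, LinearMap.rTensor_tmul, LinearMap.lTensor_tmul] at key
  have e1 : ∀ u z : L, TensorProduct.assoc k L L L (comul (R := k) u ⊗ₜ[k] z) =
      sweedler (fun x y => x ⊗ₜ[k] (y ⊗ₜ[k] z)) (comul (R := k) u) := by
    intro u z
    conv_lhs => rw [← sweedler_self (comul (R := k) u)]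
    rw [sweedler_tmul', le_sweedler]; rfl
  simp only [e1] at key
  simp (disch := fun_prop) only [sweedler_sweedler, sweedler_tmul] at key
  exact key

theorem sw_counit_l {f : L → M} (hf : IsLinearMap k f) (ℓ : L) :
    sweedler (fun x y => counit (R := k) x • f y) (comul (R := k) ℓ) = f ℓ := by
  have key := congrArg (fun t => sweedler (fun c y => c • f y) t)
    (rTensor_counit_comul (R := k) ℓ)
  simp (disch := fun_prop) only [sweedler_tmul, one_smul] at key
  rw [← key]
  conv_rhs => rw [← sweedler_self (comul (R := k) ℓ), lm_sweedler]
  simp (disch := fun_prop) only [sweedler_sweedler, LinearMap.rTensor_tmul, sweedler_tmul]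

theorem sw_counit_r {f : L → M} (hf : IsLinearMap k f) (ℓ : L) :
    sweedler (fun x y => counit (R := k) y • f x) (comul (R := k) ℓ) = f ℓ := by
  have key := congrArg (fun t => sweedler (fun y c => c • f y) t)
    (lTensor_counit_comul (R := k) ℓ)
  simp (disch := fun_prop) only [sweedler_tmul, one_smul] at key
  rw [← key]
  conv_rhs => rw [← sweedler_self (comul (R := k) ℓ), lm_sweedler]
  simp (disch := fun_prop) only [sweedler_sweedler, LinearMap.lTensor_tmul, sweedler_tmul]

end

section
variable [Ring L] [HopfAlgebra k L]

theorem sw_mul {f : L → L → M} (h1 : ∀ y, IsLinearMap k (fun x => f x y))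
    (h2 : ∀ x, IsLinearMap k (fun y => f x y)) (a b : L) :
    sweedler f (comul (R := k) (a * b)) = sweedler (fun a₁ a₂ => sweedler
      (fun b₁ b₂ => f (a₁ * b₁) (a₂ * b₂)) (comul (R := k) b)) (comul (R := k) a) := by
  rw [Bialgebra.comul_mul]
  conv_lhs => rw [← sweedler_self (comul (R := k) a), ← sweedler_self (comul (R := k) b)]
  simp only [sweedler_mul, mul_sweedler]
  simp (disch := fun_prop) only [sweedler_sweedler, Algebra.TensorProduct.tmul_mul_tmul,
    sweedler_tmul]
  exact sweedler_comm ..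

theorem sw_one {f : L → L → M} (h1 : ∀ y, IsLinearMap k (fun x => f x y))
    (h2 : ∀ x, IsLinearMap k (fun y => f x y)) :
    sweedler f (comul (R := k) (1 : L)) = f 1 1 := by
  rw [Bialgebra.comul_one, Algebra.TensorProduct.one_def, sweedler_tmul h1 h2]

theorem sw_antipode_l {f : L → M} (hf : IsLinearMap k f) (ℓ : L) :
    sweedler (fun x y => f (antipode k x * y)) (comul (R := k) ℓ) =
      counit (R := k) ℓ • f 1 := by
  have key := congrArg f (mul_antipode_rTensor_comul_apply (R := k) ℓ)
  rw [Algebra.algebraMap_eq_smul_one, hf.map_smul] at key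
  rw [← key]
  conv_rhs => rw [← sweedler_self (comul (R := k) ℓ), lm_sweedler, lm_sweedler, map_sweedler hf]
  rfl

theorem sw_antipode_r {f : L → M} (hf : IsLinearMap k f) (ℓ : L) :
    sweedler (fun x y => f (x * antipode k y)) (comul (R := k) ℓ) =
      counit (R := k) ℓ • f 1 := by
  have key := congrArg f (mul_antipode_lTensor_comul_apply (R := k) ℓ)
  rw [Algebra.algebraMap_eq_smul_one, hf.map_smul] at key
  rw [← key]
  conv_rhs => rw [← sweedler_self (comul (R := k) ℓ), lm_sweedler, lm_sweedler, map_sweedler hf]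
  rfl

/-- The antipode is anti-comultiplicative. -/
theorem comul_antipode (ℓ : L) :
    comul (R := k) (antipode k ℓ) =
      sweedler (fun x y => antipode k y ⊗ₜ[k] antipode k x) (comul (R := k) ℓ) := by
  -- both sides are convolution inverses of `comul`
  have hT : ∀ u : L, sweedler (fun x y => sweedler (fun a b => antipode k b ⊗ₜ[k] antipode k a)
      (comul (R := k) x) * comul (R := k) y) (comul (R := k) u) = counit (R := k) u • 1 := by
    intro u
    have e : ∀ x y : L, sweedler (fun a b => antipode k b ⊗ₜ[k] antipode k a)
        (comul (R := k) x) * comul (R := k) y = sweedler (fun a b => sweedler (fun c d =>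
          (antipode k b * c) ⊗ₜ[k] (antipode k a * d)) (comul (R := k) y))
          (comul (R := k) x) := by
      intro x y
      conv_lhs => rw [← sweedler_self (comul (R := k) y)]
      simp only [sweedler_mul, mul_sweedler, Algebra.TensorProduct.tmul_mul_tmul]
      exact sweedler_comm ..
    simp only [e]
    rw [sw_coassoc (by fun_prop) (by fun_prop) (by fun_prop)]
    have e2 : ∀ a v : L, sweedler (fun b w => sweedler (fun c d =>
          (antipode k b * c) ⊗ₜ[k] (antipode k a * d)) (comul (R := k) w)) (comul (R := k) v) =
          (1 : L) ⊗ₜ[k] (antipode k a * v) := by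
      intro a v
      rw [← sw_coassoc (by fun_prop) (by fun_prop) (by fun_prop)]
      have : ∀ u d : L, sweedler (fun x y => (antipode k x * y) ⊗ₜ[k] (antipode k a * d))
          (comul (R := k) u) = counit (R := k) u • (1 : L) ⊗ₜ[k] (antipode k a * d) :=
        fun u d => sw_antipode_l (f := fun t => t ⊗ₜ[k] (antipode k a * d)) (by fun_prop) u
      simp only [this]
      exact sw_counit_l (f := fun d => (1 : L) ⊗ₜ[k] (antipode k a * d)) (by fun_prop) v
    simp only [e2]
    exact sw_antipode_l (f := fun t => (1 : L) ⊗ₜ[k] t) (by fun_prop) u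
  have h1 : sweedler (fun u z => sweedler (fun x y =>
      sweedler (fun a b => antipode k b ⊗ₜ[k] antipode k a) (comul (R := k) x) *
        (comul (R := k) (y * antipode k z))) (comul (R := k) u)) (comul (R := k) ℓ) =
      comul (R := k) (antipode k ℓ) := by
    simp only [Bialgebra.comul_mul, ← mul_assoc, ← sweedler_mul, hT, smul_mul_assoc, one_mul]
    exact sw_counit_l (f := fun d => comul (R := k) (antipode k d)) (by fun_prop) ℓ
  rw [← h1, sw_coassoc (by fun_prop) (by fun_prop) (by fun_prop)]
  have h2 : ∀ x v : L, sweedler (fun y z => sweedler (fun a b => antipode k b ⊗ₜ[k] antipode k a)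
      (comul (R := k) x) * (comul (R := k) (y * antipode k z))) (comul (R := k) v) =
      counit (R := k) v • sweedler (fun a b => antipode k b ⊗ₜ[k] antipode k a)
        (comul (R := k) x) := by
    intro x v
    rw [sw_antipode_r (f := fun t => sweedler (fun a b => antipode k b ⊗ₜ[k] antipode k a)
      (comul (R := k) x) * comul (R := k) t) (by fun_prop)]
    simp
  simp only [h2]
  exact sw_counit_r (by fun_prop) ℓ

theorem sw_antipode {f : L → L → M} (h1 : ∀ y, IsLinearMap k (fun x => f x y))
    (h2 : ∀ x, IsLinearMap k (fun y => f x y)) (ℓ : L) :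
    sweedler f (comul (R := k) (antipode k ℓ)) =
      sweedler (fun x y => f (antipode k y) (antipode k x)) (comul (R := k) ℓ) := by
  rw [comul_antipode]
  simp (disch := fun_prop) only [sweedler_sweedler, sweedler_tmul]

end

end Coalg

end Sweedler

namespace Sweedler

section AntipodeBijective

variable {k L : Type*} [Field k] [Ring L] [HopfAlgebra k L]

theorem antipode_pow_mul (n : ℕ) :
    (∀ a b : L, ((antipode k : L →ₗ[k] L) ^ n) (a * b) =
      ((antipode k : L →ₗ[k] L) ^ n) a * ((antipode k : L →ₗ[k] L) ^ n) b) ∨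
    (∀ a b : L, ((antipode k : L →ₗ[k] L) ^ n) (a * b) =
      ((antipode k : L →ₗ[k] L) ^ n) b * ((antipode k : L →ₗ[k] L) ^ n) a) := by
  induction n with
  | zero => left; intro a b; rfl
  | succ n ih =>
    rcases ih with h | h
    · right; intro a b
      simp only [pow_succ', Module.End.mul_apply, h, antipode_mul_antidistrib]
    · left; intro a b
      simp only [pow_succ', Module.End.mul_apply, h, antipode_mul_antidistrib]

/-- One cancellation step: a coalgebra map `p` with `F S p = F S` satisfies `F p = F`. -/
theorem antipode_cancel (F p : L →ₗ[k] L)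
    (hF : (∀ a b, F (a * b) = F a * F b) ∨ (∀ a b, F (a * b) = F b * F a))
    (hp : ∀ x, comul (R := k) (p x) = sweedler (fun a b => p a ⊗ₜ[k] p b) (comul (R := k) x))
    (hε : ∀ x, counit (R := k) (p x) = counit (R := k) x)
    (h : ∀ x, F (antipode k (p x)) = F (antipode k x)) (x : L) : F (p x) = F x := by
  have e1 : ∀ u : L, sweedler (fun a b => p a * antipode k (p b)) (comul (R := k) u) =
      counit (R := k) u • (1 : L) := by
    intro u
    rw [← hε, ← sw_antipode_r (f := fun t : L => t) (by fun_prop) (p u), hp]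
    simp (disch := fun_prop) only [sweedler_sweedler, sweedler_tmul]
  have e2 : ∀ v : L, sweedler (fun b c => F (antipode k (p b) * c)) (comul (R := k) v) =
      counit (R := k) v • F 1 := by
    intro v
    rw [← sw_antipode_l (f := fun t : L => F t) (by fun_prop) v]
    rcases hF with hF | hF <;> simp only [hF, h]
  have e3 : sweedler (fun u c => sweedler (fun a b => F (p a * antipode k (p b) * c))
      (comul (R := k) u)) (comul (R := k) x) = F x := by
    simp only [← lm_sweedler, ← sweedler_mul, e1, smul_mul_assoc, one_mul]
    rw [sw_counit_l (f := fun t : L => t) (by fun_prop)]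
  rw [← e3, sw_coassoc (by fun_prop) (by fun_prop) (by fun_prop)]
  rcases hF with hF | hF
  · have : ∀ a v : L, sweedler (fun b c => F (p a * antipode k (p b) * c)) (comul (R := k) v) =
        counit (R := k) v • (F (p a) * F 1) := by
      intro a v
      rw [← mul_smul_comm, ← e2, mul_sweedler]
      simp only [mul_assoc, hF]
    simp only [this]
    rw [sw_counit_r (f := fun a => F (p a) * F 1) (by fun_prop), ← hF, mul_one]
  · have : ∀ a v : L, sweedler (fun b c => F (p a * antipode k (p b) * c)) (comul (R := k) v) =
        counit (R := k) v • (F 1 * F (p a)) := by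
      intro a v
      rw [← smul_mul_assoc, ← e2, sweedler_mul]
      simp only [mul_assoc, hF]
    simp only [this]
    rw [sw_counit_r (f := fun a => F 1 * F (p a)) (by fun_prop), ← hF, mul_one]

theorem comul_antipode_pow (n : ℕ) (x : L) :
    comul (R := k) (((antipode k : L →ₗ[k] L) ^ (2 * n)) x) =
      sweedler (fun a b => ((antipode k : L →ₗ[k] L) ^ (2 * n)) a ⊗ₜ[k]
        ((antipode k : L →ₗ[k] L) ^ (2 * n)) b) (comul (R := k) x) := by
  induction n with
  | zero => exact (sweedler_self _).symm
  | succ n ih =>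
    have : 2 * (n + 1) = 2 * n + 1 + 1 := by ring
    rw [this]
    simp only [pow_succ' _ (2 * n + 1), pow_succ' _ (2 * n), Module.End.mul_apply]
    rw [comul_antipode, sw_antipode (by fun_prop) (by fun_prop), ih]
    simp (disch := fun_prop) only [sweedler_sweedler, sweedler_tmul]

theorem counit_antipode_pow (n : ℕ) (x : L) :
    counit (R := k) (((antipode k : L →ₗ[k] L) ^ n) x) = counit (R := k) x := by
  induction n with
  | zero => rfl
  | succ n ih => simp only [pow_succ', Module.End.mul_apply, counit_antipode, ih]

theorem antipode_bijective [FiniteDimensional k L] :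
    Function.Bijective (antipode k : L →ₗ[k] L) := by
  suffices hinj : Function.Injective (antipode k : L →ₗ[k] L) from
    ⟨hinj, LinearMap.injective_iff_surjective.mp hinj⟩
  obtain ⟨m, hm⟩ := Filter.eventually_atTop.mp
    (LinearMap.eventually_isCompl_ker_pow_range_pow (antipode k : L →ₗ[k] L))
  have hc := hm (2 * (m + 1)) (by omega)
  set G : L →ₗ[k] L := (antipode k : L →ₗ[k] L) ^ (2 * (m + 1)) with hG
  have hker : LinearMap.ker (G ∘ₗ G) ≤ LinearMap.ker G := by
    intro x hx
    have h1 : G x ∈ LinearMap.ker G ⊓ LinearMap.range G := ⟨hx, x, rfl⟩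
    rw [hc.inf_eq_bot] at h1
    exact h1
  have hran : ∀ x, ∃ z, G x = G (G z) := by
    intro x
    have hx : x ∈ LinearMap.ker G ⊔ LinearMap.range G := by rw [hc.sup_eq_top]; trivial
    obtain ⟨a, ha, b, ⟨z, rfl⟩, rfl⟩ := Submodule.mem_sup.mp hx
    exact ⟨z, by rw [map_add, LinearMap.mem_ker.mp ha, zero_add]⟩
  obtain ⟨q, hq⟩ : ∃ q : L →ₗ[k] L, ∀ x, q (G (G x)) = G x := by
    obtain ⟨g, hg⟩ := (G.domRestrict (LinearMap.range G)).exists_leftInverse_of_injective (by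
      rw [LinearMap.ker_eq_bot']
      rintro ⟨_, x, rfl⟩ hx
      exact Subtype.ext (hker (x := x) hx))
    refine ⟨(LinearMap.range G).subtype ∘ₗ g, fun x => ?_⟩
    exact congrArg Subtype.val (LinearMap.congr_fun hg ⟨G x, x, rfl⟩)
  have hp : ∀ x, comul (R := k) ((q ∘ₗ G) x) =
      sweedler (fun a b => (q ∘ₗ G) a ⊗ₜ[k] (q ∘ₗ G) b) (comul (R := k) x) := by
    intro x
    obtain ⟨z, hz⟩ := hran x
    have e : sweedler (fun a b => (q ∘ₗ G) a ⊗ₜ[k] (q ∘ₗ G) b) (comul (R := k) x) =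
        sweedler (fun a b => q a ⊗ₜ[k] q b) (comul (R := k) (G x)) := by
      rw [hG, comul_antipode_pow, ← hG]
      simp (disch := fun_prop) only [sweedler_sweedler, sweedler_tmul, LinearMap.comp_apply]
    rw [e, LinearMap.comp_apply, hz, hq, hG]
    simp only [comul_antipode_pow]
    rw [← hG]
    simp (disch := fun_prop) only [sweedler_sweedler, sweedler_tmul, hq]
  have hε : ∀ x, counit (R := k) ((q ∘ₗ G) x) = counit (R := k) x := by
    intro x
    obtain ⟨z, hz⟩ := hran x
    have h1 : ∀ y, counit (R := k) (G y) = counit (R := k) y := counit_antipode_pow _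
    rw [LinearMap.comp_apply, hz, hq, ← h1 x, hz, h1, h1, h1]
  have hdesc : ∀ j : ℕ, (∀ x, ((antipode k : L →ₗ[k] L) ^ j) ((q ∘ₗ G) x) =
      ((antipode k : L →ₗ[k] L) ^ j) x) → ∀ x, (q ∘ₗ G) x = x := by
    intro j
    induction j with
    | zero => exact fun h => h
    | succ j ih =>
      intro h
      apply ih
      refine antipode_cancel _ _ (antipode_pow_mul j) hp hε ?_
      intro x
      simpa only [pow_succ, Module.End.mul_apply] using h x
  have hid := hdesc (2 * (m + 1)) (by
    intro x
    obtain ⟨z, hz⟩ := hran x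
    rw [← hG, LinearMap.comp_apply, hz, hq])
  intro x y hxy
  have hGxy : G x = G y := by
    have : 2 * (m + 1) = 2 * m + 1 + 1 := by ring
    rw [hG, this, pow_succ, Module.End.mul_apply, hxy, Module.End.mul_apply]
  rw [← hid x, ← hid y, LinearMap.comp_apply, hGxy, LinearMap.comp_apply]

end AntipodeBijective

end Sweedler

/-- The inverse of the antipode of a finite-dimensional Hopf algebra. -/
noncomputable def antipodeInv (k L : Type*) [Field k] [Ring L] [HopfAlgebra k L]
    [FiniteDimensional k L] : L →ₗ[k] L :=
  (LinearEquiv.ofBijective (antipode k : L →ₗ[k] L) Sweedler.antipode_bijective).symm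

theorem antipode_antipodeInv {k L : Type*} [Field k] [Ring L] [HopfAlgebra k L]
    [FiniteDimensional k L] (ℓ : L) : antipode k (antipodeInv k L ℓ) = ℓ :=
  (LinearEquiv.ofBijective (antipode k : L →ₗ[k] L) Sweedler.antipode_bijective).apply_symm_apply ℓ

/-! ### Weak Hopf algebras and their integrals -/

/-- A weak Hopf algebra over the field `k`: a `k`-algebra which is also a `k`-coalgebra, whose
comultiplication is multiplicative (but need not preserve the unit), with the weakened
compatibility axioms and an antipode. -/
class WeakHopfAlgebra (k H : Type*) [Field k] [Ring H] [Algebra k H] extends Coalgebra k H where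
  /-- `Δ(ab) = Δ(a)Δ(b)` -/
  comul_mul' : ∀ a b : H, comul (a * b) = comul a * comul b
  /-- `ε(abc) = ε(ab₁)ε(b₂c)` -/
  counit_mul_left : ∀ a b c : H, counit (a * b * c) =
    sweedler (fun b₁ b₂ => counit (a * b₁) * counit (b₂ * c)) (comul b)
  /-- `ε(abc) = ε(ab₂)ε(b₁c)` -/
  counit_mul_right : ∀ a b c : H, counit (a * b * c) =
    sweedler (fun b₁ b₂ => counit (a * b₂) * counit (b₁ * c)) (comul b)
  /-- `Δ²(1) = (Δ(1) ⊗ 1)(1 ⊗ Δ(1))` -/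
  comul_one_left : comul.lTensor H (comul 1) =
    TensorProduct.assoc k H H H (comul (1 : H) ⊗ₜ[k] (1 : H)) * ((1 : H) ⊗ₜ[k] comul (1 : H))
  /-- `Δ²(1) = (1 ⊗ Δ(1))(Δ(1) ⊗ 1)` -/
  comul_one_right : comul.lTensor H (comul 1) =
    ((1 : H) ⊗ₜ[k] comul (1 : H)) * TensorProduct.assoc k H H H (comul (1 : H) ⊗ₜ[k] (1 : H))
  /-- the antipode -/
  antipode : H →ₗ[k] H
  /-- `S(h₁)h₂ = εₛ(h)`, where `εₛ(h) = 1₁ ε(h1₂)` -/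
  antipode_mul : ∀ h : H, sweedler (fun h₁ h₂ => antipode h₁ * h₂) (comul h) =
    sweedler (fun u v => counit (h * v) • u) (comul (1 : H))
  /-- `h₁S(h₂) = εₜ(h)`, where `εₜ(h) = ε(1₁h) 1₂` -/
  mul_antipode : ∀ h : H, sweedler (fun h₁ h₂ => h₁ * antipode h₂) (comul h) =
    sweedler (fun u v => counit (u * h) • v) (comul (1 : H))
  /-- `S(h₁)h₂S(h₃) = S(h)` -/
  antipode_mul_antipode : ∀ h : H, sweedler (fun h₁ h' => sweedler (fun h₂ h₃ =>
    antipode h₁ * h₂ * antipode h₃) (comul h')) (comul h) = antipode h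

namespace WeakHopfAlgebra

variable {k H : Type*} [Field k] [Ring H] [Algebra k H] [WeakHopfAlgebra k H]

variable (k) in
/-- The target counital map `εₜ(x) = ε(1₁x) 1₂`. -/
noncomputable def targetCounital (x : H) : H :=
  sweedler (fun u v => counit (R := k) (u * x) • v) (comul (R := k) (1 : H))

variable (k) in
/-- `Λ` is a left integral if `hΛ = εₜ(h)Λ` for all `h`. -/
def IsLeftIntegral (Λ : H) : Prop := ∀ h : H, h * Λ = targetCounital k h * Λ

variable (k) in
/-- The map `Ψ_Λ : H* → H`, `φ ↦ Λ₁ φ(Λ₂)`. -/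
noncomputable def integralMap (Λ : H) (φ : Module.Dual k H) : H :=
  sweedler (fun u v => φ v • u) (comul (R := k) Λ)

variable (k) in
/-- An integral `Λ` is non-degenerate if `Ψ_Λ` is a bijection. -/
def IsNondegenerate (Λ : H) : Prop := Function.Bijective (integralMap k Λ)

end WeakHopfAlgebra

/-! ### Quantum transformation groupoids -/

/-- The data from which a quantum transformation groupoid is built: a right `L`-module algebra
structure on `B` and a symmetric separability idempotent `e = e¹ ⊗ e²` of `B` (so that `B` is
strongly separable) which is compatible with the action. -/
structure TransformationDatum (k L B : Type*) [Field k] [Ring L] [HopfAlgebra k L] [Ring B]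
    [Algebra k B] where
  /-- the action `b ◁ ℓ` -/
  act : B →ₗ[k] L →ₗ[k] B
  /-- `(b ◁ ℓ) ◁ ℓ' = b ◁ (ℓℓ')` -/
  act_act : ∀ b ℓ ℓ', act (act b ℓ) ℓ' = act b (ℓ * ℓ')
  /-- `b ◁ 1 = b` -/
  act_one : ∀ b, act b 1 = b
  /-- `(bb') ◁ ℓ = (b ◁ ℓ₁)(b' ◁ ℓ₂)` -/
  mul_act : ∀ b b' ℓ, act (b * b') ℓ =
    sweedler (fun ℓ₁ ℓ₂ => act b ℓ₁ * act b' ℓ₂) (comul (R := k) ℓ)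
  /-- `1 ◁ ℓ = ε(ℓ)1` -/
  one_act : ∀ ℓ, act 1 ℓ = counit (R := k) ℓ • (1 : B)
  /-- the symmetric separability idempotent `e¹ ⊗ e²` -/
  e : B ⊗[k] B
  /-- `be¹ ⊗ e² = e¹ ⊗ e²b` -/
  mul_e : ∀ b, sweedler (fun e₁ e₂ => (b * e₁) ⊗ₜ[k] e₂) e =
    sweedler (fun e₁ e₂ => e₁ ⊗ₜ[k] (e₂ * b)) e
  /-- `e¹e² = 1` -/
  e_mul : sweedler (fun e₁ e₂ => e₁ * e₂) e = 1
  /-- `e¹ ⊗ e² = e² ⊗ e¹` -/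
  e_symm : e = sweedler (fun e₁ e₂ => e₂ ⊗ₜ[k] e₁) e
  /-- `(e¹ ◁ ℓ) ⊗ e² = e¹ ⊗ (e² ◁ S(ℓ))` -/
  act_e : ∀ ℓ, sweedler (fun e₁ e₂ => act e₁ ℓ ⊗ₜ[k] e₂) e =
    sweedler (fun e₁ e₂ => e₁ ⊗ₜ[k] act e₂ (antipode k ℓ)) e

namespace TransformationDatum

open Sweedler

variable {k L B M : Type*} [Field k] [Ring L] [HopfAlgebra k L] [Ring B] [Algebra k B]
  [AddCommGroup M] [Module k M] (D : TransformationDatum k L B)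

theorem sw_e_symm {f : B → B → M} (h1 : ∀ y, IsLinearMap k (fun x => f x y))
    (h2 : ∀ x, IsLinearMap k (fun y => f x y)) :
    sweedler f D.e = sweedler (fun x y => f y x) D.e := by
  conv_lhs => rw [D.e_symm]
  simp (disch := fun_prop) only [sweedler_sweedler, sweedler_tmul]

theorem sw_mul_e {f : B → B → M} (h1 : ∀ y, IsLinearMap k (fun x => f x y))
    (h2 : ∀ x, IsLinearMap k (fun y => f x y))
    (b : B) :
    sweedler (fun x y => f (b * x) y) D.e = sweedler (fun x y => f x (y * b)) D.e := by
  have := congrArg (sweedler f) (D.mul_e b)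
  simpa (disch := fun_prop) only [sweedler_sweedler, sweedler_tmul] using this

theorem sw_e_mul {f : B → B → M} (h1 : ∀ y, IsLinearMap k (fun x => f x y))
    (h2 : ∀ x, IsLinearMap k (fun y => f x y))
    (b : B) :
    sweedler (fun x y => f (x * b) y) D.e = sweedler (fun x y => f x (b * y)) D.e := by
  rw [D.sw_e_symm (by fun_prop) (by fun_prop),
    ← D.sw_mul_e (f := fun x y => f y x) (by fun_prop) (by fun_prop),
    D.sw_e_symm (by fun_prop) (by fun_prop)]

theorem sw_act_e {f : B → B → M} (h1 : ∀ y, IsLinearMap k (fun x => f x y))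
    (h2 : ∀ x, IsLinearMap k (fun y => f x y))
    (ℓ : L) :
    sweedler (fun x y => f (D.act x ℓ) y) D.e =
      sweedler (fun x y => f x (D.act y (antipode k ℓ))) D.e := by
  have := congrArg (sweedler f) (D.act_e ℓ)
  simpa (disch := fun_prop) only [sweedler_sweedler, sweedler_tmul] using this

theorem sw_act_e' {f : B → B → M} (h1 : ∀ y, IsLinearMap k (fun x => f x y))
    (h2 : ∀ x, IsLinearMap k (fun y => f x y))
    (ℓ : L) :
    sweedler (fun x y => f (D.act x (antipode k ℓ)) y) D.e =
      sweedler (fun x y => f x (D.act y ℓ)) D.e := by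
  rw [D.sw_e_symm (by fun_prop) (by fun_prop),
    ← D.sw_act_e (f := fun x y => f y x) (by fun_prop) (by fun_prop),
    D.sw_e_symm (by fun_prop) (by fun_prop)]

theorem sw_e_one {f : B → M} (h : IsLinearMap k f) :
    sweedler (fun x y => f (x * y)) D.e = f 1 := by
  rw [← D.e_mul, map_sweedler h]

theorem sw_mul_act {f : B → M} (h : IsLinearMap k f) (b b' : B) (ℓ : L) :
    f (D.act (b * b') ℓ) =
      sweedler (fun ℓ₁ ℓ₂ => f (D.act b ℓ₁ * D.act b' ℓ₂)) (comul (R := k) ℓ) := by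
  rw [D.mul_act, map_sweedler h]

/-- The trace form `ω` exists and is unique. -/
theorem existsUnique_traceForm [FiniteDimensional k B] :
    ∃! ω : B →ₗ[k] k, sweedler (fun e₁ e₂ => ω e₁ • e₂) D.e = 1 ∧
      sweedler (fun e₁ e₂ => ω e₂ • e₁) D.e = 1 := by
  have ex : ∃ ω : B →ₗ[k] k, sweedler (fun e₁ e₂ => ω e₁ • e₂) D.e = 1 := by
    let b := Module.finBasis k B
    refine ⟨∑ i, b.coord i ∘ₗ LinearMap.mulRight k (b i), ?_⟩
    calc _ = ∑ i, sweedler (fun e₁ e₂ => b.coord i (e₁ * b i) • e₂) D.e := by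
          simp only [sweedler, LinearMap.sum_apply, Finset.sum_smul]
          rw [Finset.sum_comm]; rfl
      _ = ∑ i, sweedler (fun e₁ e₂ => (b.coord i e₁ • b i) * e₂) D.e := by
          refine Finset.sum_congr rfl fun i _ => ?_
          rw [D.sw_e_mul (f := fun x y => b.coord i x • y) (by fun_prop) (by fun_prop)]
          simp only [smul_mul_assoc]
      _ = sweedler (fun e₁ e₂ => e₁ * e₂) D.e := by
          simp only [sweedler]
          rw [Finset.sum_comm]
          refine Finset.sum_congr rfl fun p _ => ?_
          rw [← Finset.sum_mul]
          congr 1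
          exact b.sum_repr p.1
      _ = 1 := D.e_mul
  obtain ⟨ω, hω⟩ := ex
  refine ⟨ω, ⟨hω, ?_⟩, ?_⟩
  · rw [← hω]
    exact D.sw_e_symm (f := fun e₁ e₂ => ω e₂ • e₁) (by fun_prop) (by fun_prop)
  · rintro φ ⟨hφ, -⟩
    ext x
    have hx : sweedler (fun e₁ e₂ => ω (x * e₁) • e₂) D.e = x := by
      rw [D.sw_mul_e (f := fun e₁ e₂ => ω e₁ • e₂) (by fun_prop) (by fun_prop)]
      simp only [← smul_mul_assoc]
      rw [← sweedler_mul, hω, one_mul]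
    calc φ x = sweedler (fun e₁ e₂ => ω (x * e₁) * φ e₂) D.e := by
          conv_lhs => rw [← hx, lm_sweedler]
          simp only [map_smul, smul_eq_mul]
      _ = sweedler (fun e₁ e₂ => ω (x * (φ e₁ • e₂))) D.e := by
          rw [D.sw_e_symm (by fun_prop) (by fun_prop)]
          simp only [mul_smul_comm, map_smul, smul_eq_mul, mul_comm]
      _ = ω x := by
          rw [← map_sweedler (φ := fun t => ω (x * t)) (by fun_prop), hφ, mul_one]

/-- The trace form `ω : B → k`, defined by `ω(e¹)e² = 1 = e¹ω(e²)`. -/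
noncomputable def traceForm [FiniteDimensional k B] : B →ₗ[k] k :=
  D.existsUnique_traceForm.choose

section TraceForm

variable [FiniteDimensional k B]

theorem sw_trace {f : B → M} (h : IsLinearMap k f) :
    sweedler (fun x y => D.traceForm x • f y) D.e = f 1 := by
  rw [← D.existsUnique_traceForm.choose_spec.1.1, map_sweedler h]
  simp only [h.map_smul]
  rfl

theorem sw_trace_mul {f : B → M} (h : IsLinearMap k f) (b : B) :
    sweedler (fun x y => D.traceForm (b * x) • f y) D.e = f b := by
  rw [D.sw_mul_e (f := fun x y => D.traceForm x • f y) (by fun_prop) (by fun_prop),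
    D.sw_trace (f := fun y => f (y * b)) (by fun_prop), one_mul]

theorem sw_trace_mul' {f : B → M} (h : IsLinearMap k f) (b : B) :
    sweedler (fun x y => D.traceForm (x * b) • f y) D.e = f b := by
  rw [D.sw_e_mul (f := fun x y => D.traceForm x • f y) (by fun_prop) (by fun_prop),
    D.sw_trace (f := fun y => f (b * y)) (by fun_prop), mul_one]

/-- Two functionals with the same value on `e` agree. -/
theorem dual_ext {φ ψ : B → M} (hφ : IsLinearMap k φ) (hψ : IsLinearMap k ψ)
    (h : sweedler (fun x y => φ x ⊗ₜ[k] y) D.e = sweedler (fun x y => ψ x ⊗ₜ[k] y) D.e) (b : B) :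
    φ b = ψ b := by
  have key := congrArg (sweedler fun m y => D.traceForm (b * y) • m) h
  simp (disch := fun_prop) only [sweedler_sweedler, sweedler_tmul] at key
  rw [D.sw_e_symm (by fun_prop) (by fun_prop), D.sw_trace_mul hφ,
    D.sw_e_symm (by fun_prop) (by fun_prop), D.sw_trace_mul hψ] at key
  exact key

theorem traceForm_comm (a b : B) : D.traceForm (a * b) = D.traceForm (b * a) := by
  refine D.dual_ext (φ := fun a => D.traceForm (a * b)) (ψ := fun a => D.traceForm (b * a))
    (by fun_prop) (by fun_prop) ?_ a
  rw [D.sw_e_mul (f := fun x y => D.traceForm x ⊗ₜ[k] y) (by fun_prop) (by fun_prop),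
    D.sw_mul_e (f := fun x y => D.traceForm x ⊗ₜ[k] y) (by fun_prop) (by fun_prop)]
  have : ∀ (c : k) (y : B), c ⊗ₜ[k] y = (1 : k) ⊗ₜ[k] (c • y) := by
    intro c y; rw [← TensorProduct.smul_tmul, smul_eq_mul, mul_one]
  simp only [this (D.traceForm _)]
  simp only [TensorProduct.tmul_smul]
  rw [D.sw_trace (f := fun y => (1 : k) ⊗ₜ[k] (b * y)) (by fun_prop),
    D.sw_trace (f := fun y => (1 : k) ⊗ₜ[k] (y * b)) (by fun_prop), one_mul, mul_one]

theorem traceForm_act (b : B) (ℓ : L) :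
    D.traceForm (D.act b ℓ) = counit (R := k) ℓ * D.traceForm b := by
  refine D.dual_ext (φ := fun b => D.traceForm (D.act b ℓ))
    (ψ := fun b => counit (R := k) ℓ * D.traceForm b) (by fun_prop) (by fun_prop) ?_ b
  rw [D.sw_act_e (f := fun x y => D.traceForm x ⊗ₜ[k] y) (by fun_prop) (by fun_prop)]
  have : ∀ (c : k) (y : B), c ⊗ₜ[k] y = c • ((1 : k) ⊗ₜ[k] y) := by
    intro c y; rw [TensorProduct.smul_tmul', smul_eq_mul, mul_one]
  simp only [this (D.traceForm _), this (_ * D.traceForm _), mul_smul]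
  rw [D.sw_trace (f := fun y => (1 : k) ⊗ₜ[k] (D.act y (antipode k ℓ))) (by fun_prop),
    ← smul_sweedler, D.sw_trace (f := fun y => (1 : k) ⊗ₜ[k] y) (by fun_prop), D.one_act,
    counit_antipode, TensorProduct.tmul_smul]

theorem act_antipode_antipode (b : B) (ℓ : L) :
    D.act b (antipode k (antipode k ℓ)) = D.act b ℓ := by
  refine D.dual_ext (φ := fun b => D.act b (antipode k (antipode k ℓ)))
    (ψ := fun b => D.act b ℓ) (by fun_prop) (by fun_prop) ?_ b
  rw [D.sw_act_e' (f := fun x y => x ⊗ₜ[k] y) (by fun_prop) (by fun_prop),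
    D.sw_act_e (f := fun x y => x ⊗ₜ[k] y) (by fun_prop) (by fun_prop)]

theorem traceForm_act_mul (a b : B) (ℓ : L) :
    D.traceForm (D.act a ℓ * b) = D.traceForm (a * D.act b (antipode k ℓ)) := by
  have e1 : ∀ u v : L, counit (R := k) v • D.traceForm (D.act b (antipode k u) * a) =
      sweedler (fun x y => D.traceForm (D.act b (antipode k u * x) * D.act a y))
        (comul (R := k) v) := by
    intro u v
    rw [smul_eq_mul, ← D.traceForm_act, D.mul_act, lm_sweedler]
    simp only [D.act_act]
  rw [D.traceForm_comm a, ← sw_counit_r (k := k) (f := fun u => D.traceForm (D.act b (antipode k u) * a))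
    (by fun_prop) ℓ]
  simp only [e1]
  rw [← sw_coassoc (by fun_prop) (by fun_prop) (by fun_prop)]
  have e2 : ∀ u z : L, sweedler (fun x y => D.traceForm (D.act b (antipode k x * y) * D.act a z))
      (comul (R := k) u) = counit (R := k) u • D.traceForm (b * D.act a z) := by
    intro u z
    rw [sw_antipode_l (f := fun t => D.traceForm (D.act b t * D.act a z)) (by fun_prop), D.act_one]
  simp only [e2]
  rw [sw_counit_l (f := fun z => D.traceForm (b * D.act a z)) (by fun_prop), D.traceForm_comm]

theorem traceForm_mul_act_antipodeInv [FiniteDimensional k L] (a b : B) (ℓ : L) :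
    D.traceForm (a * D.act b (antipodeInv k L ℓ)) = D.traceForm (D.act a ℓ * b) := by
  rw [D.traceForm_act_mul]
  conv_rhs => rw [← antipode_antipodeInv (k := k) ℓ, D.act_antipode_antipode]

end TraceForm

end TransformationDatum

/-- The underlying vector space `Bᵒᵖ ⊗ L ⊗ B` of the quantum transformation groupoid `H(L, B)`. -/
def QTG {k L B : Type*} [Field k] [Ring L] [HopfAlgebra k L] [Ring B] [Algebra k B]
    (_D : TransformationDatum k L B) : Type _ := Bᵐᵒᵖ ⊗[k] (L ⊗[k] B)

namespace QTG

open Sweedler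

variable {k L B M X : Type*} [Field k] [Ring L] [HopfAlgebra k L] [Ring B] [Algebra k B]
  [AddCommGroup M] [Module k M] [AddCommGroup X] [Module k X] (D : TransformationDatum k L B)

noncomputable instance instAddCommGroup : AddCommGroup (QTG D) :=
  inferInstanceAs (AddCommGroup (Bᵐᵒᵖ ⊗[k] (L ⊗[k] B)))

noncomputable instance instModule : Module k (QTG D) :=
  inferInstanceAs (Module k (Bᵐᵒᵖ ⊗[k] (L ⊗[k] B)))

/-- The pure tensor `a ⊗ ℓ ⊗ b` in `H(L, B)`. -/
noncomputable def tm (a : B) (ℓ : L) (b : B) : QTG D :=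
  (MulOpposite.op a ⊗ₜ[k] (ℓ ⊗ₜ[k] b) : Bᵐᵒᵖ ⊗[k] (L ⊗[k] B))

theorem lin_op : IsLinearMap k (fun a : B => MulOpposite.op a) := ⟨fun _ _ => rfl, fun _ _ => rfl⟩

theorem lin_unop : IsLinearMap k (fun a : Bᵐᵒᵖ => a.unop) := ⟨fun _ _ => rfl, fun _ _ => rfl⟩

@[fun_prop] theorem lin_tm₁ {g : X → B} (hg : IsLinearMap k g) (ℓ : L) (b : B) :
    IsLinearMap k (fun x => tm D (g x) ℓ b) :=
  lin_tmul_l (lin_comp lin_op hg) (ℓ ⊗ₜ[k] b)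

@[fun_prop] theorem lin_tm₂ {g : X → L} (hg : IsLinearMap k g) (a b : B) :
    IsLinearMap k (fun x => tm D a (g x) b) :=
  lin_tmul_r (lin_tmul_l hg b) (MulOpposite.op a)

@[fun_prop] theorem lin_tm₃ {g : X → B} (hg : IsLinearMap k g) (a : B) (ℓ : L) :
    IsLinearMap k (fun x => tm D a ℓ (g x)) :=
  lin_tmul_r (lin_tmul_r hg ℓ) (MulOpposite.op a)

/-- The linear map out of `H(L, B)` induced by a trilinear map. -/
noncomputable def lift3 (f : B → L → B → M) (h1 : ∀ ℓ b, IsLinearMap k (fun a => f a ℓ b))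
    (h2 : ∀ a b, IsLinearMap k (fun ℓ => f a ℓ b)) (h3 : ∀ a ℓ, IsLinearMap k (fun b => f a ℓ b)) :
    QTG D →ₗ[k] M :=
  TensorProduct.lift (M := Bᵐᵒᵖ) (N := L ⊗[k] B) (IsLinearMap.mk' (fun a : Bᵐᵒᵖ =>
    IsLinearMap.mk' (fun t : L ⊗[k] B => sweedler (fun ℓ b => f a.unop ℓ b) t) (by fun_prop))
    ⟨fun x y => LinearMap.ext fun t => by
        simp [sweedler, (h1 _ _).map_add, Finset.sum_add_distrib],
      fun c x => LinearMap.ext fun t => by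
        simp [sweedler, (h1 _ _).map_smul, Finset.smul_sum]⟩)

theorem lift3_tm {f : B → L → B → M} (h1 : ∀ ℓ b, IsLinearMap k (fun a => f a ℓ b))
    (h2 : ∀ a b, IsLinearMap k (fun ℓ => f a ℓ b)) (h3 : ∀ a ℓ, IsLinearMap k (fun b => f a ℓ b))
    (a : B) (ℓ : L) (b : B) : lift3 D f h1 h2 h3 (tm D a ℓ b) = f a ℓ b := by
  simp only [lift3, tm]
  erw [TensorProduct.lift.tmul]
  exact sweedler_tmul (h2 a) (h3 a) ℓ b

variable {D} in
theorem induction_tm {P : QTG D → Prop} (h0 : P 0) (h : ∀ a ℓ b, P (tm D a ℓ b))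
    (hadd : ∀ x y, P x → P y → P (x + y)) (x : QTG D) : P x := by
  refine TensorProduct.induction_on (motive := P) x h0 ?_ hadd
  intro a t
  induction t using TensorProduct.induction_on with
  | zero => rw [TensorProduct.tmul_zero]; exact h0
  | tmul ℓ b => exact h a.unop ℓ b
  | add t s ht hs => rw [TensorProduct.tmul_add]; exact hadd _ _ ht hs

variable {D} in
theorem lin_ext {φ ψ : QTG D → M} (hφ : IsLinearMap k φ) (hψ : IsLinearMap k ψ)
    (h : ∀ a ℓ b, φ (tm D a ℓ b) = ψ (tm D a ℓ b)) (x : QTG D) : φ x = ψ x := by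
  induction x using induction_tm with
  | h0 => exact (hφ.mk' φ).map_zero.trans (hψ.mk' ψ).map_zero.symm
  | h a ℓ b => exact h a ℓ b
  | hadd x y hx hy => rw [hφ.map_add, hψ.map_add, hx, hy]

@[fun_prop] theorem lin_lift3 {f : X → B → L → B → M}
    (h0 : ∀ a ℓ b, IsLinearMap k (fun x => f x a ℓ b))
    (h1 : ∀ x ℓ b, IsLinearMap k (fun a => f x a ℓ b))
    (h2 : ∀ x a b, IsLinearMap k (fun ℓ => f x a ℓ b))
    (h3 : ∀ x a ℓ, IsLinearMap k (fun b => f x a ℓ b)) :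
    IsLinearMap k (fun x => lift3 D (f x) (h1 x) (h2 x) (h3 x)) := by
  constructor
  · intro x y
    refine LinearMap.ext (lin_ext (by fun_prop) (by fun_prop) fun a ℓ b => ?_)
    simp only [LinearMap.add_apply, lift3_tm, (h0 _ _ _).map_add]
  · intro c x
    refine LinearMap.ext (lin_ext (by fun_prop) (by fun_prop) fun a ℓ b => ?_)
    simp only [LinearMap.smul_apply, lift3_tm, (h0 _ _ _).map_smul]

/-- The multiplication
`(a ⊗ ℓ ⊗ b)(a' ⊗ ℓ' ⊗ b') = (a' ◁ S(ℓ₁))a ⊗ ℓ₂ℓ'₁ ⊗ (b ◁ ℓ'₂)b'`. -/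
noncomputable def mulMap : QTG D →ₗ[k] QTG D →ₗ[k] QTG D :=
  lift3 D (fun a ℓ b => lift3 D (fun a' ℓ' b' =>
      sweedler (fun ℓ₁ ℓ₂ => sweedler (fun ℓ'₁ ℓ'₂ =>
        tm D (D.act a' (antipode k ℓ₁) * a) (ℓ₂ * ℓ'₁) (D.act b ℓ'₂ * b'))
        (comul (R := k) ℓ')) (comul (R := k) ℓ))
    (by fun_prop) (by fun_prop) (by fun_prop))
  (by fun_prop) (by fun_prop) (by fun_prop)

noncomputable instance : Mul (QTG D) := ⟨fun x y => mulMap D x y⟩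

/-- The unit is `1 ⊗ 1 ⊗ 1`. -/
noncomputable instance : One (QTG D) := ⟨tm D 1 1 1⟩

theorem mul_eq (x y : QTG D) : x * y = mulMap D x y := rfl

theorem one_eq : (1 : QTG D) = tm D 1 1 1 := rfl

theorem tm_mul_tm (a b a' b' : B) (ℓ ℓ' : L) : tm D a ℓ b * tm D a' ℓ' b' =
    sweedler (fun ℓ₁ ℓ₂ => sweedler (fun ℓ'₁ ℓ'₂ =>
      tm D (D.act a' (antipode k ℓ₁) * a) (ℓ₂ * ℓ'₁) (D.act b ℓ'₂ * b'))
      (comul (R := k) ℓ')) (comul (R := k) ℓ) := by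
  rw [mul_eq, mulMap, lift3_tm, lift3_tm]

theorem mulMap_one_left (x : QTG D) : mulMap D 1 x = x := by
  revert x
  refine lin_ext (k := k) (by fun_prop) (by fun_prop) fun a ℓ b => ?_
  rw [← mul_eq, one_eq, tm_mul_tm]
  simp (disch := fun_prop) only [sw_one, antipode_one, D.act_one, D.one_act, one_mul, mul_one,
    smul_mul_assoc]
  have : ∀ x y : L, tm D a x (counit (R := k) y • b) = counit (R := k) y • tm D a x b :=
    fun x y => (lin_tm₃ D lin_id a x).map_smul _ _
  simp only [this]
  exact sw_counit_r (f := fun x => tm D a x b) (by fun_prop) ℓ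

theorem mulMap_one_right (x : QTG D) : mulMap D x 1 = x := by
  revert x
  refine lin_ext (k := k) (by fun_prop) (by fun_prop) fun a ℓ b => ?_
  rw [← mul_eq, one_eq, tm_mul_tm]
  simp (disch := fun_prop) only [sw_one, D.act_one, D.one_act, one_mul, mul_one,
    smul_mul_assoc, counit_antipode]
  have : ∀ x y : L, tm D (counit (R := k) y • a) x b = counit (R := k) y • tm D a x b :=
    fun x y => (lin_tm₁ D lin_id x b).map_smul _ _
  simp only [this]
  exact sw_counit_l (f := fun x => tm D a x b) (by fun_prop) ℓ

theorem tm_sweedler₁ {U V : Type*} [AddCommGroup U] [Module k U] [AddCommGroup V] [Module k V]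
    (f : U → V → B) (t : U ⊗[k] V) (ℓ : L) (b : B) :
    tm D (sweedler f t) ℓ b = sweedler (fun u v => tm D (f u v) ℓ b) t :=
  map_sweedler (lin_tm₁ D lin_id ℓ b) f t

theorem tm_sweedler₃ {U V : Type*} [AddCommGroup U] [Module k U] [AddCommGroup V] [Module k V]
    (f : U → V → B) (t : U ⊗[k] V) (a : B) (ℓ : L) :
    tm D a ℓ (sweedler f t) = sweedler (fun u v => tm D a ℓ (f u v)) t :=
  map_sweedler (lin_tm₃ D lin_id a ℓ) f t

theorem tm_smul₁ (c : k) (a : B) (ℓ : L) (b : B) : tm D (c • a) ℓ b = c • tm D a ℓ b :=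
  (lin_tm₁ D lin_id ℓ b).map_smul _ _

theorem tm_smul₃ (c : k) (a : B) (ℓ : L) (b : B) : tm D a ℓ (c • b) = c • tm D a ℓ b :=
  (lin_tm₃ D lin_id a ℓ).map_smul _ _

theorem sw_tm_left (a c x y : B) (m ℓ : L) :
    sweedler (fun ℓ₁ ℓ₂ => tm D (D.act (x * y) (antipode k ℓ₁) * a) (ℓ₂ * m) c)
      (comul (R := k) ℓ) =
    sweedler (fun ℓ₁ w => sweedler (fun ℓ₂ ℓ₃ => tm D (D.act x (antipode k ℓ₂) *
      (D.act y (antipode k ℓ₁) * a)) (ℓ₃ * m) c) (comul (R := k) w)) (comul (R := k) ℓ) := by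
  rw [← sw_coassoc (by fun_prop) (by fun_prop) (by fun_prop)]
  simp only [D.mul_act]
  simp (disch := fun_prop) only [sw_antipode, sweedler_mul, tm_sweedler₁, mul_assoc]

theorem sw_tm_right (a c x y : B) (m ℓ : L) :
    sweedler (fun ℓ₁ ℓ₂ => tm D a (m * ℓ₁) (D.act (x * y) ℓ₂ * c)) (comul (R := k) ℓ) =
    sweedler (fun ℓ₁ w => sweedler (fun ℓ₂ ℓ₃ => tm D a (m * ℓ₁) (D.act x ℓ₂ *
      (D.act y ℓ₃ * c))) (comul (R := k) w)) (comul (R := k) ℓ) := by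
  simp only [D.mul_act, sweedler_mul, tm_sweedler₃, mul_assoc]

theorem sw_block_comm {U V : Type*} [AddCommGroup U] [Module k U] [AddCommGroup V] [Module k V]
    (F : U → V → L → L → L → M) (t : U ⊗[k] V) (ℓ : L) :
    sweedler (fun a b => sweedler (fun c d => sweedler (fun e f => F a b c e f)
      (comul (R := k) d)) (comul (R := k) ℓ)) t =
    sweedler (fun c d => sweedler (fun e f => sweedler (fun a b => F a b c e f) t)
      (comul (R := k) d)) (comul (R := k) ℓ) := by
  rw [sweedler_comm]
  congr 1; funext c d
  rw [sweedler_comm]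

theorem mulMap_assoc (x y z : QTG D) :
    mulMap D (mulMap D x y) z = mulMap D x (mulMap D y z) := by
  revert x
  refine lin_ext (k := k) (by fun_prop) (by fun_prop) fun a ℓ b => ?_
  revert y
  refine lin_ext (k := k) (by fun_prop) (by fun_prop) fun a' ℓ' b' => ?_
  revert z
  refine lin_ext (k := k) (by fun_prop) (by fun_prop) fun a'' ℓ'' b'' => ?_
  simp only [← mul_eq, tm_mul_tm]
  simp only [mul_eq, lm_sweedler, app_sweedler]
  simp only [← mul_eq, tm_mul_tm]
  simp (disch := fun_prop) only [sw_mul, antipode_mul_antidistrib, ← D.act_act]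
  have hL : ∀ f s, _ := fun f s => sweedler_comm (U := L) (V := L) (U' := L) (V' := L)
    (M := QTG D) f (comul (R := k) ℓ') s
  conv_lhs =>
    simp only [hL, sw_tm_right]
    simp (disch := fun_prop) only [sw_coassoc]
  have hR : ∀ f s, _ := fun f s => sweedler_comm (U := L) (V := L) (U' := L) (V' := L)
    (M := QTG D) f (comul (R := k) ℓ) s
  have hR' : ∀ f s, _ := fun f s => sweedler_comm (U := L) (V := L) (U' := L) (V' := L)
    (M := QTG D) f (comul (R := k) ℓ'') s
  conv_rhs =>
    simp only [hR, sw_tm_left]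
    simp only [hR']
    simp (disch := fun_prop) only [sw_coassoc]
    simp only [sw_block_comm _ _ ℓ]
  simp only [mul_assoc]

noncomputable instance instRing : Ring (QTG D) :=
  { instAddCommGroup D with
    mul := fun x y => mulMap D x y
    one := tm D 1 1 1
    left_distrib := fun x y z => (mulMap D x).map_add y z
    right_distrib := fun x y z => LinearMap.congr_fun ((mulMap D).map_add x y) z
    zero_mul := fun x => LinearMap.congr_fun (mulMap D).map_zero x
    mul_zero := fun x => (mulMap D x).map_zero
    mul_assoc := mulMap_assoc D
    one_mul := mulMap_one_left D
    mul_one := mulMap_one_right D }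

noncomputable instance instAlgebra : Algebra k (QTG D) :=
  Algebra.ofModule
    (fun c x y => LinearMap.congr_fun ((mulMap D).map_smul c x) y)
    (fun c x y => (mulMap D x).map_smul c y)

end QTG

namespace QTG

open Sweedler

variable {k L B M X : Type*} [Field k] [Ring L] [HopfAlgebra k L] [Ring B] [Algebra k B]
  [AddCommGroup M] [Module k M] [AddCommGroup X] [Module k X] (D : TransformationDatum k L B)

/-- The comultiplication
`Δ(a ⊗ ℓ ⊗ b) = (a ⊗ ℓ₁ ⊗ e¹) ⊗ ((e² ◁ S(ℓ₂)) ⊗ ℓ₃ ⊗ b)`. -/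
noncomputable def comulMap : QTG D →ₗ[k] QTG D ⊗[k] QTG D :=
  lift3 D (fun a ℓ b => sweedler (fun ℓ₁ w => sweedler (fun ℓ₂ ℓ₃ => sweedler (fun e₁ e₂ =>
      tm D a ℓ₁ e₁ ⊗ₜ[k] tm D (D.act e₂ (antipode k ℓ₂)) ℓ₃ b)
      D.e) (comul (R := k) w)) (comul (R := k) ℓ))
    (by fun_prop) (by fun_prop) (by fun_prop)

/-- The counit `ε(a ⊗ ℓ ⊗ b) = ω(a(b ◁ S⁻¹(ℓ)))`. -/
noncomputable def counitMap [FiniteDimensional k L] [FiniteDimensional k B] : QTG D →ₗ[k] k :=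
  lift3 D (fun a ℓ b => D.traceForm (a * D.act b (antipodeInv k L ℓ)))
    (by fun_prop) (by fun_prop) (by fun_prop)

/-- The antipode `S(a ⊗ ℓ ⊗ b) = b ⊗ S(ℓ) ⊗ a`. -/
noncomputable def antipodeMap : QTG D →ₗ[k] QTG D :=
  lift3 D (fun a ℓ b => tm D b (antipode k ℓ) a) (by fun_prop) (by fun_prop) (by fun_prop)

theorem comulMap_tm (a b : B) (ℓ : L) : comulMap D (tm D a ℓ b) =
    sweedler (fun ℓ₁ w => sweedler (fun ℓ₂ ℓ₃ => sweedler (fun e₁ e₂ =>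
      tm D a ℓ₁ e₁ ⊗ₜ[k] tm D (D.act e₂ (antipode k ℓ₂)) ℓ₃ b)
      D.e) (comul (R := k) w)) (comul (R := k) ℓ) := by
  rw [comulMap, lift3_tm]

theorem counitMap_tm [FiniteDimensional k L] [FiniteDimensional k B] (a b : B) (ℓ : L) :
    counitMap D (tm D a ℓ b) = D.traceForm (a * D.act b (antipodeInv k L ℓ)) := by
  rw [counitMap, lift3_tm]

theorem counitMap_tm' [FiniteDimensional k L] [FiniteDimensional k B] (a b : B) (ℓ : L) :
    counitMap D (tm D a ℓ b) = D.traceForm (D.act a ℓ * b) := by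
  rw [counitMap_tm, D.traceForm_mul_act_antipodeInv]

theorem antipodeMap_tm (a b : B) (ℓ : L) :
    antipodeMap D (tm D a ℓ b) = tm D b (antipode k ℓ) a := by
  rw [antipodeMap, lift3_tm]

theorem comulMap_coassoc (x : QTG D) :
    TensorProduct.assoc k (QTG D) (QTG D) (QTG D) ((comulMap D).rTensor (QTG D) (comulMap D x)) =
      (comulMap D).lTensor (QTG D) (comulMap D x) := by
  revert x
  refine lin_ext (k := k) ?_ (by fun_prop) fun a ℓ b => ?_
  · exact ((TensorProduct.assoc k (QTG D) (QTG D) (QTG D)).toLinearMap ∘ₗ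
      (comulMap D).rTensor (QTG D) ∘ₗ comulMap D).isLinear
  simp only [comulMap_tm, lm_sweedler, le_sweedler, LinearMap.rTensor_tmul, LinearMap.lTensor_tmul,
    sweedler_tmul', tmul_sweedler, TensorProduct.assoc_tmul]
  have hE : ∀ (f : B → B → L → L → QTG D ⊗[k] (QTG D ⊗[k] QTG D)) s, _ :=
    fun f s => sweedler_comm f D.e s
  simp only [hE]
  conv_lhs =>
    enter [1, u, v]
    rw [sw_block_comm]
  simp (disch := fun_prop) only [sw_coassoc]
  conv_lhs =>
    enter [1, u, v, 1, u, v, 1, u, v, 1, u, v]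
    rw [sweedler_comm]

/-- Counit axioms. -/
theorem counitMap_left [FiniteDimensional k L] [FiniteDimensional k B] (x : QTG D) :
    sweedler (fun u v => counitMap D u • v) (comulMap D x) = x := by
  revert x
  refine lin_ext (k := k) (by fun_prop) (by fun_prop) fun a ℓ b => ?_
  simp (disch := fun_prop) only [comulMap_tm, sweedler_sweedler, sweedler_tmul, counitMap_tm']
  have h1 : ∀ x y z : L, sweedler (fun e₁ e₂ => D.traceForm (D.act a x * e₁) •
      tm D (D.act e₂ (antipode k y)) z b) D.e = tm D (D.act a (x * antipode k y)) z b := by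
    intro x y z
    rw [D.sw_trace_mul (f := fun t => tm D (D.act t (antipode k y)) z b) (by fun_prop), D.act_act]
  simp only [h1]
  rw [← sw_coassoc (by fun_prop) (by fun_prop) (by fun_prop)]
  have h2 : ∀ u z : L, sweedler (fun x y => tm D (D.act a (x * antipode k y)) z b)
      (comul (R := k) u) = counit (R := k) u • tm D a z b := by
    intro u z
    rw [sw_antipode_r (f := fun t => tm D (D.act a t) z b) (by fun_prop), D.act_one]
  simp only [h2]
  rw [sw_counit_l (f := fun z => tm D a z b) (by fun_prop)]

theorem counitMap_right [FiniteDimensional k L] [FiniteDimensional k B] (x : QTG D) :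
    sweedler (fun u v => counitMap D v • u) (comulMap D x) = x := by
  revert x
  refine lin_ext (k := k) (by fun_prop) (by fun_prop) fun a ℓ b => ?_
  simp (disch := fun_prop) only [comulMap_tm, sweedler_sweedler, sweedler_tmul, counitMap_tm']
  simp only [D.act_act]
  have h1 : ∀ x w : L, sweedler (fun y z => sweedler (fun e₁ e₂ =>
      D.traceForm (D.act e₂ (antipode k y * z) * b) • tm D a x e₁) D.e) (comul (R := k) w) =
      counit (R := k) w • tm D a x b := by
    intro x w
    rw [sw_antipode_l (f := fun t => sweedler (fun e₁ e₂ =>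
      D.traceForm (D.act e₂ t * b) • tm D a x e₁) D.e) (by fun_prop)]
    simp only [D.act_one]
    rw [D.sw_e_symm (by fun_prop) (by fun_prop), D.sw_trace_mul' (by fun_prop)]
  simp only [h1]
  rw [sw_counit_r (f := fun z => tm D a z b) (by fun_prop)]

/-! Multiplicativity of the comultiplication. -/

theorem tm_mul_tm_left (a a' c : B) (ℓ m : L) : tm D a ℓ 1 * tm D a' m c =
    sweedler (fun ℓ₁ ℓ₂ => tm D (D.act a' (antipode k ℓ₁) * a) (ℓ₂ * m) c)
      (comul (R := k) ℓ) := by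
  rw [tm_mul_tm]
  simp only [D.one_act, smul_mul_assoc, one_mul, tm_smul₃]
  congr 1; funext x y
  rw [sw_counit_r (f := fun z => tm D (D.act a' (antipode k x) * a) (y * z) c) (by fun_prop)]

theorem tm_mul_tm_right (a b c : B) (ℓ m : L) : tm D a ℓ b * tm D 1 m c =
    sweedler (fun m₁ m₂ => tm D a (ℓ * m₁) (D.act b m₂ * c)) (comul (R := k) m) := by
  rw [tm_mul_tm]
  simp only [D.one_act, smul_mul_assoc, one_mul, tm_smul₁, counit_antipode]
  simp only [← smul_sweedler]
  rw [sw_counit_l (f := fun y => sweedler (fun m₁ m₂ => tm D a (y * m₁) (D.act b m₂ * c))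
    (comul (R := k) m)) (by fun_prop)]

theorem tm_mul_tm_one (a b c : B) (ℓ : L) : tm D a ℓ b * tm D c 1 1 =
    sweedler (fun ℓ₁ ℓ₂ => tm D (D.act c (antipode k ℓ₁) * a) ℓ₂ b) (comul (R := k) ℓ) := by
  rw [tm_mul_tm]
  simp (disch := fun_prop) only [sw_one, D.act_one, mul_one]

theorem tm_one_mul_tm (a b c : B) (m : L) : tm D 1 1 b * tm D a m c =
    sweedler (fun m₁ m₂ => tm D a m₁ (D.act b m₂ * c)) (comul (R := k) m) := by
  rw [tm_mul_tm]
  simp (disch := fun_prop) only [sw_one, D.act_one, mul_one, one_mul, antipode_one]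

theorem tm_op_mul_tm (a b c : B) (m : L) : tm D c 1 1 * tm D a m b = tm D (a * c) m b := by
  rw [tm_mul_tm_left]
  simp (disch := fun_prop) only [sw_one, D.act_one, one_mul, antipode_one]

theorem comulMap_one : comulMap D 1 =
    sweedler (fun e₁ e₂ => tm D 1 1 e₁ ⊗ₜ[k] tm D e₂ 1 1) D.e := by
  rw [one_eq, comulMap_tm]
  simp (disch := fun_prop) only [sw_one, D.act_one, antipode_one]

/-- `Δ(a ⊗ ℓ ⊗ b) = ((a ⊗ ℓ₁ ⊗ 1) ⊗ (1 ⊗ ℓ₂ ⊗ b)) Δ(1)`. -/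
theorem comulMap_eq (a b : B) (ℓ : L) : comulMap D (tm D a ℓ b) =
    sweedler (fun ℓ₁ ℓ₂ => tm D a ℓ₁ 1 ⊗ₜ[k] tm D 1 ℓ₂ b) (comul (R := k) ℓ) * comulMap D 1 := by
  rw [comulMap_tm, comulMap_one, sweedler_mul]
  congr 1; funext ℓ₁ w
  rw [sweedler_comm, mul_sweedler]
  congr 1; funext e₁ e₂
  rw [Algebra.TensorProduct.tmul_mul_tmul, tm_mul_tm_one, tmul_sweedler, tm_mul_tm_right]
  simp (disch := fun_prop) only [sw_one, D.act_one, one_mul, mul_one]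

theorem sw_act_mul_act (F : B → M) (hF : IsLinearMap k F) (b c : B) (t : L) :
    sweedler (fun x y => F (D.act (b * D.act c x) (antipode k y))) (comul (R := k) t) =
      F (D.act b (antipode k t) * c) := by
  simp (disch := fun_prop) only [D.mul_act, sw_antipode, map_sweedler hF, D.act_act]
  rw [← sw_coassoc (by fun_prop) (by fun_prop) (by fun_prop)]
  have : ∀ u z : L, sweedler (fun x y => F (D.act b (antipode k z) * D.act c (x * antipode k y)))
      (comul (R := k) u) = counit (R := k) u • F (D.act b (antipode k z) * c) := by
    intro u z
    rw [sw_antipode_r (f := fun t => F (D.act b (antipode k z) * D.act c t)) (by fun_prop),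
      D.act_one]
  simp only [this]
  rw [sw_counit_l (f := fun z => F (D.act b (antipode k z) * c)) (by fun_prop)]

/-- `Δ(1)Δ(y) = Δ(y)`. -/
theorem comulMap_one_mul (y : QTG D) : comulMap D 1 * comulMap D y = comulMap D y := by
  revert y
  refine lin_ext (k := k) (by fun_prop) (by fun_prop) fun a ℓ b => ?_
  rw [comulMap_one, comulMap_tm]
  simp only [sweedler_mul, mul_sweedler, Algebra.TensorProduct.tmul_mul_tmul, tm_one_mul_tm,
    tm_op_mul_tm, sweedler_tmul']
  have hE : ∀ (f : B → B → L → L → QTG D ⊗[k] QTG D) s, _ :=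
    fun f s => sweedler_comm f D.e s
  simp only [hE]
  conv_lhs =>
    enter [1, u, v]
    rw [sweedler_comm]
  simp (disch := fun_prop) only [sw_coassoc]
  congr 1; funext m₁ v
  rw [← sw_coassoc (by fun_prop) (by fun_prop) (by fun_prop)]
  congr 1; funext t z
  have h1 : ∀ x y e₁ e₂, sweedler (fun f₁ f₂ => tm D a m₁ (D.act e₁ x * f₁) ⊗ₜ[k]
      tm D (D.act f₂ (antipode k y) * e₂) z b) D.e =
      sweedler (fun f₁ f₂ => tm D a m₁ f₁ ⊗ₜ[k]
        tm D (D.act (f₂ * D.act e₁ x) (antipode k y) * e₂) z b) D.e := by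
    intro x y e₁ e₂
    exact D.sw_mul_e (f := fun f₁ f₂ => tm D a m₁ f₁ ⊗ₜ[k]
        tm D (D.act f₂ (antipode k y) * e₂) z b) (by fun_prop) (by fun_prop) (D.act e₁ x)
  have h2 : ∀ f₁ f₂ e₁ e₂, sweedler (fun x y => tm D a m₁ f₁ ⊗ₜ[k]
        tm D (D.act (f₂ * D.act e₁ x) (antipode k y) * e₂) z b) (comul (R := k) t) =
      tm D a m₁ f₁ ⊗ₜ[k] tm D (D.act f₂ (antipode k t) * e₁ * e₂) z b := by
    intro f₁ f₂ e₁ e₂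
    exact sw_act_mul_act D (fun s => tm D a m₁ f₁ ⊗ₜ[k] tm D (s * e₂) z b) (by fun_prop) f₂ e₁ t
  have hE' : ∀ (f : L → L → B → B → QTG D ⊗[k] QTG D) s, _ :=
    fun f s => sweedler_comm f s D.e
  have h3 : ∀ f₁ f₂, sweedler (fun e₁ e₂ => tm D a m₁ f₁ ⊗ₜ[k]
        tm D (D.act f₂ (antipode k t) * e₁ * e₂) z b) D.e =
      tm D a m₁ f₁ ⊗ₜ[k] tm D (D.act f₂ (antipode k t)) z b := by
    intro f₁ f₂
    simp only [mul_assoc]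
    rw [D.sw_e_one (f := fun s => tm D a m₁ f₁ ⊗ₜ[k]
      tm D (D.act f₂ (antipode k t) * s) z b) (by fun_prop), mul_one]
  conv_lhs =>
    enter [1, x, y]
    rw [sweedler_comm]
  simp only [h1, hE', h2]
  rw [sweedler_comm]
  simp only [h3]

theorem comulMap_mul (x y : QTG D) : comulMap D (x * y) = comulMap D x * comulMap D y := by
  revert x
  refine lin_ext (k := k) (by fun_prop) (by fun_prop) fun a ℓ b => ?_
  rw [comulMap_eq, mul_assoc, comulMap_one_mul]
  revert y
  refine lin_ext (k := k) (by fun_prop) (by fun_prop) fun a' m b' => ?_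
  rw [tm_mul_tm]
  simp only [lm_sweedler, comulMap_tm]
  simp (disch := fun_prop) only [sw_mul]
  simp only [sweedler_mul, mul_sweedler, Algebra.TensorProduct.tmul_mul_tmul, tm_mul_tm_left]
  simp only [tm_mul_tm, sweedler_tmul', tmul_sweedler]
  have hE : ∀ (f : B → B → L → L → QTG D ⊗[k] QTG D) s, _ :=
    fun f s => sweedler_comm f D.e s
  simp only [hE]
  have hL : ∀ (t : L) (f : L → L → L → L → QTG D ⊗[k] QTG D) s, _ :=
    fun t f s => sweedler_comm f s (comul (R := k) t)
  conv_lhs =>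
    enter [1, ℓ₁, u]
    rw [sweedler_comm]
    enter [1, u₁, u₂]
    simp only [hL u₂]
  conv_rhs =>
    simp only [hL ℓ]
    enter [1, ℓ₁, ℓ₂]
    simp only [hL ℓ₂]
    simp only [hL ℓ₁]
  simp (disch := fun_prop) only [sw_coassoc]
  simp only [mul_one, antipode_mul_antidistrib, D.act_act]

end QTG

namespace QTG

open Sweedler

variable {k L B M X : Type*} [Field k] [Ring L] [HopfAlgebra k L] [Ring B] [Algebra k B]
  [AddCommGroup M] [Module k M] [AddCommGroup X] [Module k X] (D : TransformationDatum k L B)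

/-! The weak Hopf algebra structure. -/

/-- The right action of `H(L, B)` on `B`, `c · (a ⊗ ℓ ⊗ b) = ((ac) ◁ ℓ)b`. -/
noncomputable def actB : QTG D →ₗ[k] B →ₗ[k] B :=
  lift3 D (fun a ℓ b => IsLinearMap.mk' (fun c => D.act (a * c) ℓ * b) (by fun_prop))
    (fun ℓ b => ⟨fun x y => by ext c; simp [add_mul], fun t x => by ext c; simp⟩)
    (fun a b => ⟨fun x y => by ext c; simp [add_mul], fun t x => by ext c; simp⟩)
    (fun a ℓ => ⟨fun x y => by ext c; simp [mul_add], fun t x => by ext c; simp⟩)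

theorem actB_tm (a b c : B) (ℓ : L) : actB D (tm D a ℓ b) c = D.act (a * c) ℓ * b := by
  rw [actB, lift3_tm]; rfl

theorem sw_act_act {F : B → M} (hF : IsLinearMap k F) (b c : B) (ℓ : L) :
    sweedler (fun x y => F (D.act (D.act b (antipode k x) * c) y)) (comul (R := k) ℓ) =
      F (b * D.act c ℓ) := by
  simp (disch := fun_prop) only [D.mul_act, map_sweedler hF, D.act_act]
  rw [← sw_coassoc (by fun_prop) (by fun_prop) (by fun_prop)]
  have : ∀ u z : L, sweedler (fun x y => F (D.act b (antipode k x * y) * D.act c z))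
      (comul (R := k) u) = counit (R := k) u • F (b * D.act c z) := by
    intro u z
    rw [sw_antipode_l (f := fun t => F (D.act b t * D.act c z)) (by fun_prop), D.act_one]
  simp only [this]
  rw [sw_counit_l (f := fun z => F (b * D.act c z)) (by fun_prop)]

theorem sw_act_antipode_mul {F : B → M} (hF : IsLinearMap k F) (b c : B) (ℓ : L) :
    sweedler (fun x y => F (D.act b (antipode k y) * D.act c (antipode k x)))
      (comul (R := k) ℓ) = F (D.act (b * c) (antipode k ℓ)) := by
  simp (disch := fun_prop) only [D.mul_act, map_sweedler hF, sw_antipode]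

theorem actB_mul (x y : QTG D) (c : B) : actB D (x * y) c = actB D y (actB D x c) := by
  revert x
  refine lin_ext (k := k) (by fun_prop) (by fun_prop) fun a ℓ b => ?_
  revert y
  refine lin_ext (k := k) (by fun_prop) (by fun_prop) fun a' m b' => ?_
  rw [tm_mul_tm, lm_sweedler, app_sweedler]
  simp only [lm_sweedler, app_sweedler, actB_tm]
  rw [sweedler_comm]
  simp only [mul_assoc, ← D.act_act]
  have h : ∀ m₁ m₂ : L, sweedler (fun ℓ₁ ℓ₂ => D.act (D.act (D.act a' (antipode k ℓ₁) * (a * c)) ℓ₂)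
      m₁ * (D.act b m₂ * b')) (comul (R := k) ℓ) =
      D.act (a' * D.act (a * c) ℓ) m₁ * (D.act b m₂ * b') := fun m₁ m₂ =>
    sw_act_act D (F := fun t => D.act t m₁ * (D.act b m₂ * b')) (by fun_prop) a' (a * c) ℓ
  simp only [h]
  rw [← mul_assoc a', D.mul_act (a' * D.act (a * c) ℓ), sweedler_mul]
  simp only [mul_assoc]

variable [FiniteDimensional k L] [FiniteDimensional k B]

theorem counitMap_eq (x : QTG D) : counitMap D x = D.traceForm (actB D x 1) := by
  revert x
  refine lin_ext (k := k) (by fun_prop) (by fun_prop) fun a ℓ b => ?_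
  rw [counitMap_tm', actB_tm, mul_one]

noncomputable instance instCoalgebra : Coalgebra k (QTG D) where
  comul := comulMap D
  counit := counitMap D
  coassoc := LinearMap.ext (comulMap_coassoc D)
  rTensor_counit_comp_comul := by
    ext x
    conv_lhs => rw [LinearMap.comp_apply, ← sweedler_self (comulMap D x), lm_sweedler]
    conv_rhs => rw [← counitMap_left D x, lm_sweedler]
    congr 1; funext u v
    simp [TensorProduct.smul_tmul']
  lTensor_counit_comp_comul := by
    ext x
    conv_lhs => rw [LinearMap.comp_apply, ← sweedler_self (comulMap D x), lm_sweedler]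
    conv_rhs => rw [← counitMap_right D x, lm_sweedler]
    congr 1; funext u v
    rw [LinearMap.lTensor_tmul, LinearMap.flip_apply, TensorProduct.mk_apply,
      TensorProduct.smul_tmul, smul_eq_mul, mul_one]

theorem comul_eq (x : QTG D) : comul (R := k) x = comulMap D x := rfl

theorem counit_eq (x : QTG D) : counit (R := k) x = counitMap D x := rfl

theorem counitMap_mul_left (x y z : QTG D) : counitMap D (x * y * z) =
    sweedler (fun u v => counitMap D (x * u) * counitMap D (v * z)) (comulMap D y) := by
  simp only [counitMap_eq, actB_mul]
  generalize actB D x 1 = c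
  revert y
  refine lin_ext (k := k) (by fun_prop) (by fun_prop) fun a ℓ b => ?_
  simp (disch := fun_prop) only [comulMap_tm, sweedler_sweedler, sweedler_tmul, actB_tm]
  simp only [mul_one, D.act_act]
  have h : ∀ x w : L, sweedler (fun y z' => sweedler (fun e₁ e₂ =>
      D.traceForm (D.act (a * c) x * e₁) * D.traceForm (actB D z (D.act e₂ (antipode k y * z') * b)))
      D.e) (comul (R := k) w) = counit (R := k) w •
        D.traceForm (actB D z (D.act (a * c) x * b)) := by
    intro x w
    rw [sw_antipode_l (f := fun t => sweedler (fun e₁ e₂ =>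
      D.traceForm (D.act (a * c) x * e₁) * D.traceForm (actB D z (D.act e₂ t * b))) D.e)
      (by fun_prop)]
    simp only [D.act_one, ← smul_eq_mul (D.traceForm _)]
    rw [D.sw_trace_mul (f := fun t => D.traceForm (actB D z (t * b))) (by fun_prop)]
  simp only [h]
  rw [sw_counit_r (f := fun x => D.traceForm (actB D z (D.act (a * c) x * b))) (by fun_prop)]

theorem counitMap_mul_right (x y z : QTG D) : counitMap D (x * y * z) =
    sweedler (fun u v => counitMap D (x * v) * counitMap D (u * z)) (comulMap D y) := by
  simp only [counitMap_eq, actB_mul]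
  generalize actB D x 1 = c
  revert y
  refine lin_ext (k := k) (by fun_prop) (by fun_prop) fun a ℓ b => ?_
  simp (disch := fun_prop) only [comulMap_tm, sweedler_sweedler, sweedler_tmul, actB_tm]
  simp only [mul_one]
  have hE : ∀ (f : L → L → B → B → k) s, _ := fun f s => sweedler_comm f s D.e
  simp only [hE]
  have h : ∀ (e₁ e₂ : B) (x w : L), sweedler (fun y z' =>
      D.traceForm (D.act (D.act e₂ (antipode k y) * c) z' * b) *
        D.traceForm (actB D z (D.act a x * e₁))) (comul (R := k) w) =
      D.traceForm (e₂ * D.act c w * b) * D.traceForm (actB D z (D.act a x * e₁)) :=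
    fun e₁ e₂ x w => sw_act_act D (F := fun t => D.traceForm (t * b) *
      D.traceForm (actB D z (D.act a x * e₁))) (by fun_prop) e₂ c w
  have h' : ∀ x w : L, sweedler (fun e₁ e₂ => D.traceForm (e₂ * D.act c w * b) *
      D.traceForm (actB D z (D.act a x * e₁))) D.e =
      D.traceForm (actB D z (D.act a x * (D.act c w * b))) := by
    intro x w
    rw [D.sw_e_symm (by fun_prop) (by fun_prop)]
    simp only [mul_assoc, ← smul_eq_mul (D.traceForm _)]
    rw [D.sw_trace_mul' (f := fun t => D.traceForm (actB D z (D.act a x * t))) (by fun_prop)]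
  have hE' : ∀ (f : B → B → L → L → k) s, _ := fun f s => sweedler_comm f D.e s
  conv_rhs => simp only [h, hE', h']
  simp only [D.mul_act, sweedler_mul, lm_sweedler, mul_assoc]

theorem sweedler_mul_sweedler {A : Type*} [Ring A] [Algebra k A]
    (f g : B → B → A ⊗[k] (A ⊗[k] A)) (s t : B ⊗[k] B) :
    sweedler f s * sweedler g t =
      sweedler (fun a b => sweedler (fun c d => f a b * g c d) t) s := by
  simp only [← mul_sweedler, ← sweedler_mul]

theorem comulMap_one_left : (comulMap D).lTensor (QTG D) (comulMap D 1) =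
    TensorProduct.assoc k (QTG D) (QTG D) (QTG D) (comulMap D 1 ⊗ₜ[k] (1 : QTG D)) *
      ((1 : QTG D) ⊗ₜ[k] comulMap D 1) := by
  rw [comulMap_one]
  simp only [lm_sweedler, sweedler_tmul', tmul_sweedler, le_sweedler, LinearMap.lTensor_tmul,
    TensorProduct.assoc_tmul, sweedler_mul_sweedler]
  simp (disch := fun_prop) only [comulMap_tm, sw_one, antipode_one, D.act_one, tmul_sweedler]
  simp only [Algebra.TensorProduct.tmul_mul_tmul, mul_one, one_mul, tm_op_mul_tm]

theorem comulMap_one_right : (comulMap D).lTensor (QTG D) (comulMap D 1) =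
    ((1 : QTG D) ⊗ₜ[k] comulMap D 1) *
    TensorProduct.assoc k (QTG D) (QTG D) (QTG D) (comulMap D 1 ⊗ₜ[k] (1 : QTG D)) := by
  rw [comulMap_one]
  simp only [lm_sweedler, sweedler_tmul', tmul_sweedler, le_sweedler, LinearMap.lTensor_tmul,
    TensorProduct.assoc_tmul, sweedler_mul_sweedler]
  simp (disch := fun_prop) only [comulMap_tm, sw_one, antipode_one, D.act_one, tmul_sweedler,
    Algebra.TensorProduct.tmul_mul_tmul, mul_one, one_mul, tm_one_mul_tm]
  rw [sweedler_comm]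

/-- `εₛ(a ⊗ ℓ ⊗ b) = 1 ⊗ 1 ⊗ (a ◁ ℓ)b`. -/
theorem source_tm (a b : B) (ℓ : L) :
    sweedler (fun u v => counitMap D (tm D a ℓ b * v) • u) (comulMap D 1) =
      tm D 1 1 (D.act a ℓ * b) := by
  simp only [counitMap_eq, actB_mul]
  rw [comulMap_one]
  simp (disch := fun_prop) only [sweedler_sweedler, sweedler_tmul, actB_tm, D.act_one, mul_one]
  rw [D.sw_e_symm (by fun_prop) (by fun_prop), D.sw_trace_mul' (by fun_prop)]

/-- `εₜ(a ⊗ ℓ ⊗ b) = (b ◁ S(ℓ))a ⊗ 1 ⊗ 1`. -/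
theorem target_tm (a b : B) (ℓ : L) :
    sweedler (fun u v => counitMap D (u * tm D a ℓ b) • v) (comulMap D 1) =
      tm D (D.act b (antipode k ℓ) * a) 1 1 := by
  simp only [counitMap_eq, actB_mul]
  rw [comulMap_one]
  simp (disch := fun_prop) only [sweedler_sweedler, sweedler_tmul, actB_tm, D.act_one, mul_one,
    one_mul]
  simp only [D.traceForm_act_mul, D.traceForm_comm _ (D.act b (antipode k ℓ)), ← mul_assoc]
  rw [D.sw_trace_mul (f := fun t => tm D t 1 1) (by fun_prop)]

theorem antipodeMap_mul (x : QTG D) :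
    sweedler (fun u v => antipodeMap D u * v) (comulMap D x) =
      sweedler (fun u v => counitMap D (x * v) • u) (comulMap D 1) := by
  revert x
  refine lin_ext (k := k) (by fun_prop) (by fun_prop) fun a ℓ b => ?_
  rw [source_tm]
  simp (disch := fun_prop) only [comulMap_tm, sweedler_sweedler, sweedler_tmul, antipodeMap_tm,
    tm_mul_tm, sw_antipode]
  have hE : ∀ (f : B → B → L → L → QTG D) s, _ := fun f s => sweedler_comm f D.e s
  simp only [hE, D.act_act, ← antipode_mul_antidistrib]
  conv_lhs =>
    enter [1, ℓ₁, w]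
    rw [sweedler_comm]
  simp (disch := fun_prop) only [sw_coassoc]
  have h1 : ∀ (c v : L), sweedler (fun d w => sweedler (fun a₁ b₁ => sweedler (fun c₁ d₁ =>
      sweedler (fun e₁ e₂ => tm D (D.act e₂ (antipode k (antipode k d * a₁)) * e₁)
        (antipode k c * c₁) (D.act a d₁ * b)) D.e) (comul (R := k) b₁)) (comul (R := k) w))
      (comul (R := k) v) = sweedler (fun c₁ d₁ => tm D 1 (antipode k c * c₁) (D.act a d₁ * b))
        (comul (R := k) v) := by
    intro c v
    rw [← sw_coassoc (by fun_prop) (by fun_prop) (by fun_prop)]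
    have h : ∀ (u w : L), sweedler (fun d a₁ => sweedler (fun c₁ d₁ =>
      sweedler (fun e₁ e₂ => tm D (D.act e₂ (antipode k (antipode k d * a₁)) * e₁)
        (antipode k c * c₁) (D.act a d₁ * b)) D.e) (comul (R := k) w)) (comul (R := k) u) =
        counit (R := k) u • sweedler (fun c₁ d₁ =>
          tm D 1 (antipode k c * c₁) (D.act a d₁ * b)) (comul (R := k) w) := by
      intro u w
      rw [sw_antipode_l (f := fun t => sweedler (fun c₁ d₁ =>
        sweedler (fun e₁ e₂ => tm D (D.act e₂ (antipode k t) * e₁)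
        (antipode k c * c₁) (D.act a d₁ * b)) D.e) (comul (R := k) w)) (by fun_prop)]
      simp only [antipode_one, D.act_one]
      congr 2; funext c₁ d₁
      rw [D.sw_e_symm (by fun_prop) (by fun_prop)]
      exact D.sw_e_one (f := fun s => tm D s (antipode k c * c₁) (D.act a d₁ * b)) (by fun_prop)
    simp only [h]
    exact sw_counit_l (f := fun w => sweedler (fun c₁ d₁ =>
          tm D 1 (antipode k c * c₁) (D.act a d₁ * b)) (comul (R := k) w)) (by fun_prop) v
  simp only [h1]
  rw [← sw_coassoc (by fun_prop) (by fun_prop) (by fun_prop)]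
  have h2 : ∀ u z : L, sweedler (fun x y => tm D 1 (antipode k x * y) (D.act a z * b))
      (comul (R := k) u) = counit (R := k) u • tm D 1 1 (D.act a z * b) := fun u z =>
    sw_antipode_l (f := fun t => tm D 1 t (D.act a z * b)) (by fun_prop) u
  simp only [h2]
  exact sw_counit_l (f := fun z => tm D 1 1 (D.act a z * b)) (by fun_prop) ℓ

theorem mul_antipodeMap (x : QTG D) :
    sweedler (fun u v => u * antipodeMap D v) (comulMap D x) =
      sweedler (fun u v => counitMap D (u * x) • v) (comulMap D 1) := by
  revert x
  refine lin_ext (k := k) (by fun_prop) (by fun_prop) fun a ℓ b => ?_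
  rw [target_tm]
  simp (disch := fun_prop) only [comulMap_tm, sweedler_sweedler, sweedler_tmul, antipodeMap_tm,
    tm_mul_tm, sw_antipode]
  have hE : ∀ (f : B → B → L → L → QTG D) s, _ := fun f s => sweedler_comm f D.e s
  have hE' : ∀ (f : L → L → B → B → QTG D) s, _ := fun f s => sweedler_comm f s D.e
  simp only [hE]
  have h1 : ∀ (ℓ₁ ℓ₂ y t : L) (e₁ e₂ : B), sweedler (fun p x =>
      tm D (D.act b (antipode k ℓ₁) * a) (ℓ₂ * antipode k y)
        (D.act e₁ (antipode k x) * D.act e₂ (antipode k p))) (comul (R := k) t) =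
      tm D (D.act b (antipode k ℓ₁) * a) (ℓ₂ * antipode k y)
        (D.act (e₁ * e₂) (antipode k t)) := fun ℓ₁ ℓ₂ y t e₁ e₂ =>
    sw_act_antipode_mul D (F := fun s => tm D (D.act b (antipode k ℓ₁) * a)
      (ℓ₂ * antipode k y) s) (by fun_prop) e₁ e₂ t
  have h2 : ∀ (ℓ₁ ℓ₂ y t : L), sweedler (fun e₁ e₂ =>
      tm D (D.act b (antipode k ℓ₁) * a) (ℓ₂ * antipode k y)
        (D.act (e₁ * e₂) (antipode k t))) D.e = counit (R := k) t •
      tm D (D.act b (antipode k ℓ₁) * a) (ℓ₂ * antipode k y) 1 := by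
    intro ℓ₁ ℓ₂ y t
    rw [D.sw_e_one (f := fun s => tm D (D.act b (antipode k ℓ₁) * a) (ℓ₂ * antipode k y)
      (D.act s (antipode k t))) (by fun_prop), D.one_act, counit_antipode, tm_smul₃]
  conv_lhs =>
    enter [1, u, v]
    rw [sweedler_comm]
  simp (disch := fun_prop) only [sw_coassoc]
  have h3 : ∀ (c d v : L), sweedler (fun a₂ b₂ => sweedler (fun c₁ d₁ =>
      sweedler (fun e₁ e₂ => tm D (D.act b (antipode k c) * a) (d * antipode k d₁)
        (D.act e₁ (antipode k c₁) * D.act e₂ (antipode k a₂))) D.e) (comul (R := k) b₂))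
      (comul (R := k) v) = tm D (D.act b (antipode k c) * a) (d * antipode k v) 1 := by
    intro c d v
    rw [← sw_coassoc (by fun_prop) (by fun_prop) (by fun_prop)]
    simp only [hE', h1, h2]
    exact sw_counit_l (f := fun w => tm D (D.act b (antipode k c) * a) (d * antipode k w) 1)
      (by fun_prop) v
  simp only [h3]
  have h4 : ∀ c v : L, sweedler (fun d w => tm D (D.act b (antipode k c) * a)
      (d * antipode k w) 1) (comul (R := k) v) = counit (R := k) v •
        tm D (D.act b (antipode k c) * a) 1 1 := fun c v =>
    sw_antipode_r (f := fun t => tm D (D.act b (antipode k c) * a) t 1) (by fun_prop) v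
  simp only [h4]
  exact sw_counit_r (f := fun c => tm D (D.act b (antipode k c) * a) 1 1) (by fun_prop) ℓ

theorem antipodeMap_mul_antipodeMap (x : QTG D) :
    sweedler (fun u w => sweedler (fun v z => antipodeMap D u * v * antipodeMap D z)
      (comulMap D w)) (comulMap D x) = antipodeMap D x := by
  have h := sw_coassoc (k := k) (f := fun u v z => antipodeMap D u * v * antipodeMap D z)
    (by fun_prop) (by fun_prop) (by fun_prop) x
  simp only [comul_eq, ← sweedler_mul, antipodeMap_mul] at h
  rw [← h]
  clear h
  revert x
  refine lin_ext (k := k) (by fun_prop) (by fun_prop) fun a ℓ b => ?_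
  simp (disch := fun_prop) only [comulMap_tm, sweedler_sweedler, sweedler_tmul, antipodeMap_tm,
    source_tm, tm_one_mul_tm, sw_antipode]
  have hE : ∀ (f : B → B → L → L → QTG D) s, _ := fun f s => sweedler_comm f D.e s
  simp only [hE]
  have h : ∀ a₁ v : L, sweedler (fun a₂ b₂ => sweedler (fun x y => sweedler (fun e₁ e₂ =>
      tm D b (antipode k y) (D.act (D.act a a₁ * e₁) (antipode k x) * D.act e₂ (antipode k a₂)))
      D.e) (comul (R := k) b₂)) (comul (R := k) v) =
      sweedler (fun t y => tm D b (antipode k y) (D.act a (a₁ * antipode k t)))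
        (comul (R := k) v) := by
    intro a₁ v
    rw [← sw_coassoc (by fun_prop) (by fun_prop) (by fun_prop)]
    congr 1; funext t y
    rw [← sweedler_comm]
    have : ∀ e₁ e₂ : B, sweedler (fun a₂ x => tm D b (antipode k y)
        (D.act (D.act a a₁ * e₁) (antipode k x) * D.act e₂ (antipode k a₂))) (comul (R := k) t) =
        tm D b (antipode k y) (D.act (D.act a a₁ * e₁ * e₂) (antipode k t)) := fun e₁ e₂ =>
      sw_act_antipode_mul D (F := fun s => tm D b (antipode k y) s) (by fun_prop) _ _ t
    simp only [this, mul_assoc]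
    rw [D.sw_e_one (f := fun s => tm D b (antipode k y) (D.act (D.act a a₁ * s) (antipode k t)))
      (by fun_prop), mul_one, D.act_act]
  simp only [h]
  rw [← sw_coassoc (by fun_prop) (by fun_prop) (by fun_prop)]
  have h' : ∀ u z : L, sweedler (fun x y => tm D b (antipode k z) (D.act a (x * antipode k y)))
      (comul (R := k) u) = counit (R := k) u • tm D b (antipode k z) a := by
    intro u z
    rw [sw_antipode_r (f := fun t => tm D b (antipode k z) (D.act a t)) (by fun_prop), D.act_one]
  simp only [h']
  exact sw_counit_l (f := fun z => tm D b (antipode k z) a) (by fun_prop) ℓ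

noncomputable instance instWeakHopfAlgebra : WeakHopfAlgebra k (QTG D) where
  comul_mul' := comulMap_mul D
  counit_mul_left := counitMap_mul_left D
  counit_mul_right := counitMap_mul_right D
  comul_one_left := comulMap_one_left D
  comul_one_right := comulMap_one_right D
  antipode := antipodeMap D
  antipode_mul := antipodeMap_mul D
  mul_antipode := mul_antipodeMap D
  antipode_mul_antipode := antipodeMap_mul_antipodeMap D

end QTG

/-! ### Integrals -/

/-- `Λ` is a right integral of the Hopf algebra `L` if `Λℓ = ε(ℓ)Λ` for all `ℓ`. -/
def HopfIsRightIntegral (k : Type*) {L : Type*} [Field k] [Ring L] [HopfAlgebra k L] (Λ : L) :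
    Prop :=
  ∀ ℓ : L, Λ * ℓ = counit (R := k) ℓ • Λ

/-- The element `(e¹ ◁ Λ₁) ⊗ S(Λ₂) ⊗ e²` of `H(L, B)`. -/
noncomputable def QTG.integral {k L B : Type*} [Field k] [Ring L] [HopfAlgebra k L] [Ring B]
    [Algebra k B] (D : TransformationDatum k L B) (Λ : L) : QTG D :=
  sweedler (fun e₁ e₂ => sweedler (fun Λ₁ Λ₂ =>
    QTG.tm D (D.act e₁ Λ₁) (antipode k Λ₂) e₂) (comul (R := k) Λ)) D.e

/-! Two mechanisms carry the proof: the separability idempotent `e` transports elements of `B`, and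
the action of `L`, from one tensor leg to the other, and a right integral transports elements of `L`
by Λ₁y ⊗ Λ₂ = Λ₁ ⊗ Λ₂S(y) (`sw_rightIntegral_mul`). Since `e` is symmetric and transport across it
turns ℓ into S(ℓ), a double transport shows that S² acts trivially on `B` (`act_antipode_antipode`).
Hence S and S⁻¹ act alike, and antipode cancellations normally reserved for S⁻¹ become available
inside the action.

Integral property. Multiplying out (a ⊗ ℓ ⊗ b)Λ̄ gives ((e¹ ◁ Λ₁S(ℓ₁))a) ⊗ ℓ₂S(Λ₃) ⊗ (b ◁ S(Λ₂))e².
Carrying b ◁ S(Λ₂) across `e` puts it under the action of Λ₁, where it simplifies to b. Distributing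
S(ℓ₁) over the product (e¹ ◁ Λ₁)b and applying the right integral property removes every remaining ℓ
except in b ◁ S(ℓ). What remains is left multiplication of Λ̄ by (b ◁ S(ℓ))a ⊗ 1 ⊗ 1, which is εₜ(a
⊗ ℓ ⊗ b) by `target_tm`. This is `tm_mul_integral`.

Non-degeneracy. The spaces H* and H have equal finite dimension, so injectivity of Ψ is enough. If
Ψ(φ) = 0, pairing the two `B`-legs of Ψ(φ) with arbitrary x and y through ω
(`contraction_integralMap`) leaves an equation in `L` alone: S(ψ(Λ₁)Λ₂) = 0 with ψ(u) = φ(x ⊗ S(u₂)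
⊗ (y ◁ S(u₁))). The antipode is injective and Λ is non-degenerate in `L`
(`rightIntegral_nondegenerate`), so ψ = 0 for all x and y. Undoing the twist by S(u₁) then gives φ =
0. -/

namespace Sweedler

/-! ### Right integrals of a finite-dimensional Hopf algebra and their non-degeneracy. -/

section HopfIntegral

variable {k L M : Type*} [Field k] [Ring L] [HopfAlgebra k L] [AddCommGroup M] [Module k M]

/-- A right integral satisfies `Λ₁y ⊗ Λ₂ = Λ₁ ⊗ Λ₂S(y)`. -/
theorem sw_rightIntegral_mul {Λ : L} (hΛ : HopfIsRightIntegral k Λ) {f : L → L → M}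
    (h1 : ∀ y, IsLinearMap k (fun x => f x y)) (h2 : ∀ x, IsLinearMap k (fun y => f x y)) (y : L) :
    sweedler (fun u v => f (u * y) v) (comul (R := k) Λ) =
      sweedler (fun u v => f u (v * antipode k y)) (comul (R := k) Λ) := by
  -- Both sides of the lemma are collapses of Λ₁y₁ ⊗ Λ₂y₂S(y₃). Reading Λ₁y₁ ⊗ Λ₂y₂ as Δ(Λy₁) and
  -- using the integral property gives the right side (`e1`); cancelling y₂S(y₃) gives the left side
  -- (`e2`).
  have e1 : sweedler (fun y₁ y₂ => sweedler (fun u v => f u (v * antipode k y₂))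
      (comul (R := k) (Λ * y₁))) (comul (R := k) y) =
      sweedler (fun u v => f u (v * antipode k y)) (comul (R := k) Λ) := by
    have : ∀ y₁ y₂ : L, sweedler (fun u v => f u (v * antipode k y₂)) (comul (R := k) (Λ * y₁)) =
        counit (R := k) y₁ • sweedler (fun u v => f u (v * antipode k y₂))
          (comul (R := k) Λ) := by
      intro y₁ y₂
      have hl : IsLinearMap k (fun t : L => sweedler (fun u v => f u (v * antipode k y₂))
        (comul (R := k) t)) := by fun_prop
      rw [hΛ, hl.map_smul]
    simp only [this]
    exact sw_counit_l (f := fun y₂ => sweedler (fun u v => f u (v * antipode k y₂))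
      (comul (R := k) Λ)) (by fun_prop) y
  have e2 : ∀ u v : L, sweedler (fun y' y₃ => sweedler (fun y₁ y₂ =>
      f (u * y₁) (v * y₂ * antipode k y₃)) (comul (R := k) y')) (comul (R := k) y) =
      f (u * y) v := by
    intro u v
    rw [sw_coassoc (by fun_prop) (by fun_prop) (by fun_prop)]
    have : ∀ y₁ w : L, sweedler (fun y₂ y₃ => f (u * y₁) (v * y₂ * antipode k y₃))
        (comul (R := k) w) = counit (R := k) w • f (u * y₁) v := by
      intro y₁ w
      simp only [mul_assoc v]
      rw [sw_antipode_r (f := fun t => f (u * y₁) (v * t)) (by fun_prop), mul_one]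
    simp only [this]
    exact sw_counit_r (f := fun y₁ => f (u * y₁) v) (by fun_prop) y
  rw [← e1]
  simp (disch := fun_prop) only [sw_mul]
  rw [sweedler_comm]
  simp only [e2]

variable [FiniteDimensional k L]

theorem antipodeInv_antipode (ℓ : L) : antipodeInv k L (antipode k ℓ) = ℓ :=
  (antipode_bijective (k := k) (L := L)).1 (antipode_antipodeInv (k := k) (antipode k ℓ))

/-- `ℓ₂S⁻¹(ℓ₁) = ε(ℓ)1`. -/
theorem sw_mul_antipodeInv {f : L → M} (hf : IsLinearMap k f) (ℓ : L) :
    sweedler (fun x y => f (y * antipodeInv k L x)) (comul (R := k) ℓ) =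
      counit (R := k) ℓ • f 1 := by
  -- Apply S⁻¹ to ℓ₁S(ℓ₂) = ε(ℓ)1; since S⁻¹ reverses products, the left side becomes ℓ₂S⁻¹(ℓ₁).
  have := sw_antipode_r (f := fun t => f (antipodeInv k L t)) (by fun_prop) ℓ
  have h1 : antipodeInv k L (1 : L) = 1 := by
    conv_lhs => rw [← antipode_one (R := k) (A := L), antipodeInv_antipode]
  have hm : ∀ x y : L, antipodeInv k L (x * antipode k y) = y * antipodeInv k L x := by
    intro x y
    apply (antipode_bijective (k := k) (L := L)).1
    rw [antipode_antipodeInv, antipode_mul_antidistrib, antipode_antipodeInv]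
  simpa only [h1, hm] using this

/-- A non-zero right integral `Λ` of a finite-dimensional Hopf algebra is non-degenerate: the
map `ψ ↦ ψ(Λ₁)Λ₂` on the dual is injective. -/
theorem rightIntegral_nondegenerate {Λ : L} (hΛ : HopfIsRightIntegral k Λ) (h0 : Λ ≠ 0)
    (ψ : Module.Dual k L) (hψ : sweedler (fun u v => ψ u • v) (comul (R := k) Λ) = 0) :
    ψ = 0 := by
  let F : Module.Dual k L →ₗ[k] L := IsLinearMap.mk'
    (fun ψ : Module.Dual k L => sweedler (fun u v => ψ u • v) (comul (R := k) Λ))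
    (lin_sweedler_f (fun u v => lin_smul_l (lin_app lin_id u) v) _)
  -- The range of F is a right ideal: writing y = S(S⁻¹(y)), right multiplication by y on Λ₂ is
  -- right multiplication by S⁻¹(y) on Λ₁, which can be absorbed into the functional.
  have hideal : ∀ ψ y, F ψ * y ∈ LinearMap.range F := by
    intro ψ y
    refine ⟨ψ ∘ₗ LinearMap.mulRight k (antipodeInv k L y), ?_⟩
    have := sw_rightIntegral_mul hΛ (f := fun u v => ψ u • v) (by fun_prop) (by fun_prop)
      (antipodeInv k L y)
    rw [antipode_antipodeInv] at this
    simpa only [F, IsLinearMap.mk'_apply, sweedler_mul, smul_mul_assoc, LinearMap.comp_apply,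
      LinearMap.mulRight_apply] using this
  obtain ⟨χ, hχ⟩ : ∃ χ : Module.Dual k L, χ Λ ≠ 0 := by
    by_contra! h
    exact h0 ((Module.forall_dual_apply_eq_zero_iff k Λ).1 h)
  have hsurj : Function.Surjective F := by
    rw [← LinearMap.range_eq_top, eq_top_iff]
    intro m _
    -- Since Λ₃S⁻¹(Λ₂) collapses to a counit, χ(Λ)m = χ(Λ₁)Λ₃S⁻¹(Λ₂)m. This places m to the right of
    -- a leg of Λ, so that the right ideal property can be used.
    have key : χ Λ • m = sweedler (fun u z => sweedler (fun x y =>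
        χ x • (z * (antipodeInv k L y * m))) (comul (R := k) u)) (comul (R := k) Λ) := by
      rw [sw_coassoc (by fun_prop) (by fun_prop) (by fun_prop)]
      have : ∀ x v : L, sweedler (fun y z => χ x • (z * (antipodeInv k L y * m)))
          (comul (R := k) v) = counit (R := k) v • χ x • m := by
        intro x v
        simp only [← mul_assoc]
        rw [sw_mul_antipodeInv (f := fun t => χ x • (t * m)) (by fun_prop), one_mul]
      simp only [this]
      exact (sw_counit_r (f := fun x => χ x • m) (by fun_prop) Λ).symm
    let b := Module.finBasis k L
    -- Expanding S⁻¹(Λ₂)m in the basis `b` turns the previous formula into a sum of products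
    -- F(ξᵢ)bᵢ, where ξᵢ collects χ on the first leg and the i-th coordinate from the second.
    let ξ : Fin (Module.finrank k L) → Module.Dual k L := fun i => IsLinearMap.mk'
      (fun u : L => sweedler (fun x y => χ x * b.coord i (antipodeInv k L y * m))
        (comul (R := k) u)) (lin_sweedler_t (by fun_prop) (by fun_prop) (by fun_prop))
    have key2 : χ Λ • m = ∑ i, F (ξ i) * b i := by
      rw [key]
      have : ∀ i, F (ξ i) * b i = sweedler (fun u z => sweedler (fun x y =>
        χ x • (z * (b.coord i (antipodeInv k L y * m) • b i))) (comul (R := k) u))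
          (comul (R := k) Λ) := by
        intro i
        simp only [F, ξ, IsLinearMap.mk'_apply, sweedler_mul, sweedler_smul, mul_smul,
          smul_mul_assoc, mul_smul_comm]
      simp only [this]
      simp only [sweedler]
      rw [Finset.sum_comm]
      refine Finset.sum_congr rfl fun p _ => ?_
      rw [Finset.sum_comm]
      refine Finset.sum_congr rfl fun q _ => ?_
      rw [← Finset.smul_sum, ← Finset.mul_sum]
      congr 2
      exact (b.sum_repr _).symm
    have : χ Λ • m ∈ LinearMap.range F := by
      rw [key2]; exact Submodule.sum_mem _ fun i _ => hideal _ _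
    simpa [smul_smul, inv_mul_cancel₀ hχ] using Submodule.smul_mem _ (χ Λ)⁻¹ this
  -- The right ideal contains χ(Λ)m for every m, and χ(Λ) is invertible, so F is onto; equality of
  -- dimensions makes it injective.
  have hinj := (LinearMap.injective_iff_surjective_of_finrank_eq_finrank
    (Subspace.dual_finrank_eq (K := k) (V := L))).2 hsurj
  exact hinj (a₁ := ψ) (a₂ := 0) (by rw [map_zero]; exact hψ)

end HopfIntegral

end Sweedler

/-! ### Cancellation rules for the action of `L` on `B`. -/

namespace TransformationDatum

open Sweedler

variable {k L B M : Type*} [Field k] [Ring L] [HopfAlgebra k L] [Ring B] [Algebra k B]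
  [AddCommGroup M] [Module k M] (D : TransformationDatum k L B) [FiniteDimensional k B]

/-- The factors stand in the order S(ℓ₂)ℓ₁, which the antipode axiom does not cancel. As S² acts
trivially, ℓ₁ may be replaced by S²(ℓ₁), and S(ℓ₂)S²(ℓ₁) = S(S(ℓ₁)ℓ₂) does cancel. -/
theorem sw_act_antipode_mul_self {f : B → M} (hf : IsLinearMap k f) (b : B) (ℓ : L) :
    sweedler (fun x y => f (D.act (D.act b (antipode k y)) x)) (comul (R := k) ℓ) =
      counit (R := k) ℓ • f b := by
  have : ∀ x y : L, D.act (D.act b (antipode k y)) x =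
      D.act b (antipode k (antipode k x * y)) := by
    intro x y
    rw [← D.act_antipode_antipode _ x, D.act_act, antipode_mul_antidistrib]
  simp only [this]
  rw [sw_antipode_l (f := fun t => f (D.act b (antipode k t))) (by fun_prop), antipode_one,
    D.act_one]

/-- The module algebra axiom splits the action into (c ◁ ℓ₁)((b ◁ S(ℓ₃)) ◁ ℓ₂), and
`sw_act_antipode_mul_self` removes ℓ₂ and ℓ₃. It frees b from the action once it has been carried
across `e`. -/
theorem sw_mul_act_antipode {f : B → M} (hf : IsLinearMap k f) (b c : B) (ℓ : L) :
    sweedler (fun x y => f (D.act (c * D.act b (antipode k y)) x)) (comul (R := k) ℓ) =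
      f (D.act c ℓ * b) := by
  simp only [D.mul_act, map_sweedler hf]
  rw [sw_coassoc (f := fun x y z => f (D.act c x * D.act (D.act b (antipode k z)) y))
    (by fun_prop) (by fun_prop) (by fun_prop)]
  have : ∀ x v : L, sweedler (fun y z => f (D.act c x * D.act (D.act b (antipode k z)) y))
      (comul (R := k) v) = counit (R := k) v • f (D.act c x * b) := fun x v =>
    D.sw_act_antipode_mul_self (f := fun t => f (D.act c x * t)) (by fun_prop) b v
  simp only [this]
  exact sw_counit_r (f := fun x => f (D.act c x * b)) (by fun_prop) ℓ

variable [FiniteDimensional k L]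

/-- This is triviality of the action of S², applied to S⁻¹(ℓ). -/
theorem act_antipodeInv (b : B) (ℓ : L) :
    D.act b (antipodeInv k L ℓ) = D.act b (antipode k ℓ) := by
  rw [← D.act_antipode_antipode, antipode_antipodeInv]

/-- A right integral `Λ` satisfies `(c ◁ Λ₁S(ℓ₁)) ⊗ ℓ₂S(Λ₂) = ε(ℓ)(c ◁ Λ₁) ⊗ S(Λ₂)`. -/
theorem sw_act_rightIntegral {Λ : L} (hΛ : HopfIsRightIntegral k Λ) {f : B → L → M}
    (h1 : ∀ y, IsLinearMap k (fun x => f x y)) (h2 : ∀ x, IsLinearMap k (fun y => f x y))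
    (c : B) (ℓ : L) :
    sweedler (fun x y => sweedler (fun u v => f (D.act (D.act c u) (antipode k x))
      (y * antipode k v)) (comul (R := k) Λ)) (comul (R := k) ℓ) =
      counit (R := k) ℓ • sweedler (fun u v => f (D.act c u) (antipode k v))
        (comul (R := k) Λ) := by
  have e : ∀ x y : L, sweedler (fun u v => f (D.act (D.act c u) (antipode k x))
      (y * antipode k v)) (comul (R := k) Λ) = sweedler (fun u v => f (D.act c u)
        (y * antipodeInv k L x * antipode k v)) (comul (R := k) Λ) := by
    intro x y
    -- The exponent −3 is chosen for what follows: transport through the integral costs one S, and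
    -- the S already applied to Λ₂ costs another. Thus S⁻³(x) arrives in the second argument as
    -- S⁻¹(x), next to y = ℓ₂, where `sw_mul_antipodeInv` applies. In the action S and S⁻³ agree.
    have : ∀ b, D.act b (antipode k x) =
        D.act b (antipodeInv k L (antipodeInv k L (antipodeInv k L x))) := by
      intro b
      rw [D.act_antipodeInv _ (antipodeInv k L _), antipode_antipodeInv, D.act_antipodeInv]
    simp only [this, D.act_act]
    rw [sw_rightIntegral_mul hΛ (f := fun u v => f (D.act c u) (y * antipode k v))
      (by fun_prop) (by fun_prop)]
    simp only [antipode_mul_antidistrib, antipode_antipodeInv, mul_assoc]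
  simp only [e]
  rw [sw_mul_antipodeInv (f := fun t => sweedler (fun u v => f (D.act c u)
        (t * antipode k v)) (comul (R := k) Λ)) (by fun_prop)]
  simp only [one_mul]

end TransformationDatum

/-! ### The left integral property in the quantum transformation groupoid. -/

namespace QTG

open Sweedler

variable {k L B : Type*} [Field k] [Ring L] [HopfAlgebra k L] [Ring B] [Algebra k B]
  (D : TransformationDatum k L B) [FiniteDimensional k B] [FiniteDimensional k L]

instance instFiniteDimensional : FiniteDimensional k (QTG D) :=
  inferInstanceAs (FiniteDimensional k (Bᵐᵒᵖ ⊗[k] (L ⊗[k] B)))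

/-- The factor on the right is the target counit of a ⊗ ℓ ⊗ b in explicit form, so this is the
integral property on pure tensors. The work lies in carrying b from the last leg to the first, where
ℓ can act on it. -/
theorem tm_mul_integral {Λ : L} (hΛ : HopfIsRightIntegral k Λ) (a b : B) (ℓ : L) :
    tm D a ℓ b * integral D Λ = tm D (D.act b (antipode k ℓ) * a) 1 1 * integral D Λ := by
  simp only [integral, mul_sweedler, tm_op_mul_tm]
  simp only [tm_mul_tm]
  simp (disch := fun_prop) only [sw_antipode]
  have e1 : ∀ (e₁ e₂ : B), sweedler (fun u w => sweedler (fun ℓ₁ ℓ₂ => sweedler (fun x y =>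
      tm D (D.act (D.act e₁ u) (antipode k ℓ₁) * a) (ℓ₂ * antipode k y)
        (D.act b (antipode k x) * e₂)) (comul (R := k) w)) (comul (R := k) ℓ))
        (comul (R := k) Λ) = sweedler (fun ℓ₁ ℓ₂ => sweedler (fun u w => sweedler (fun x y =>
      tm D (D.act (D.act e₁ u) (antipode k ℓ₁) * a) (ℓ₂ * antipode k y)
        (D.act b (antipode k x) * e₂)) (comul (R := k) w)) (comul (R := k) Λ))
        (comul (R := k) ℓ) := fun e₁ e₂ => sweedler_comm ..
  simp only [e1]
  rw [sweedler_comm]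
  simp only [sw_block_comm]
  -- Centrality of `e`: the left factor b ◁ S(Λ₂) of e² becomes a right factor of e¹.
  have e2 : ∀ ℓ₁ ℓ₂ u x y : L, sweedler (fun e₁ e₂ =>
      tm D (D.act (D.act e₁ u) (antipode k ℓ₁) * a) (ℓ₂ * antipode k y)
        (D.act b (antipode k x) * e₂)) D.e = sweedler (fun e₁ e₂ =>
      tm D (D.act (D.act (e₁ * D.act b (antipode k x)) u) (antipode k ℓ₁) * a)
        (ℓ₂ * antipode k y) e₂) D.e := fun ℓ₁ ℓ₂ u x y =>
    (D.sw_e_mul (f := fun e₁ e₂ => tm D (D.act (D.act e₁ u) (antipode k ℓ₁) * a)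
      (ℓ₂ * antipode k y) e₂) (by fun_prop) (by fun_prop) _).symm
  simp only [e2, ← sw_block_comm]
  rw [← sweedler_comm]
  congr 1; funext e₁ e₂
  -- Here (e¹(b ◁ S(Λ₂))) ◁ Λ₁ becomes (e¹ ◁ Λ₁)b. The action of S(ℓ₁) is then distributed over this
  -- product, and since S reverses the comultiplication, b receives the first component of ℓ₁ and e¹
  -- ◁ Λ₁ the second.
  have e3 : ∀ ℓ₁ ℓ₂ : L, sweedler (fun u w => sweedler (fun x y =>
      tm D (D.act (D.act (e₁ * D.act b (antipode k x)) u) (antipode k ℓ₁) * a)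
        (ℓ₂ * antipode k y) e₂) (comul (R := k) w)) (comul (R := k) Λ) =
      sweedler (fun u y => sweedler (fun p q => tm D (D.act (D.act e₁ u) (antipode k q) *
        (D.act b (antipode k p) * a)) (ℓ₂ * antipode k y) e₂) (comul (R := k) ℓ₁))
        (comul (R := k) Λ) := by
    intro ℓ₁ ℓ₂
    rw [← sw_coassoc (by fun_prop) (by fun_prop) (by fun_prop)]
    congr 1; funext u y
    rw [D.sw_mul_act_antipode (f := fun t => tm D (D.act t (antipode k ℓ₁) * a)
        (ℓ₂ * antipode k y) e₂) (by fun_prop), D.mul_act]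
    simp (disch := fun_prop) only [sw_antipode, sweedler_mul, tm_sweedler₁, mul_assoc]
  simp only [e3]
  simp only [sweedler_comm _ (comul (R := k) Λ)]
  rw [sw_coassoc (by fun_prop) (by fun_prop) (by fun_prop)]
  -- After reassociation, the two components of ℓ that meet the legs of Λ are adjacent, so
  -- `sw_act_rightIntegral` turns them into a counit. Only the component p acting on b survives.
  have e4 : ∀ p v : L, sweedler (fun q y => sweedler (fun u v => tm D
      (D.act (D.act e₁ u) (antipode k q) * (D.act b (antipode k p) * a)) (y * antipode k v) e₂)
      (comul (R := k) Λ)) (comul (R := k) v) = counit (R := k) v • sweedler (fun u v => tm D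
      (D.act e₁ u * (D.act b (antipode k p) * a)) (antipode k v) e₂) (comul (R := k) Λ) :=
    fun p v => D.sw_act_rightIntegral hΛ (f := fun s t =>
      tm D (s * (D.act b (antipode k p) * a)) t e₂) (by fun_prop) (by fun_prop) e₁ v
  simp only [e4]
  exact sw_counit_r (f := fun p => sweedler (fun u v => tm D
      (D.act e₁ u * (D.act b (antipode k p) * a)) (antipode k v) e₂) (comul (R := k) Λ))
      (by fun_prop) ℓ

/-- Both sides are linear in the element multiplying Λ̄, so pure tensors suffice; there
`tm_mul_integral` and `target_tm` produce the same element. -/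
theorem isLeftIntegral_integral {Λ : L} (hΛ : HopfIsRightIntegral k Λ) :
    WeakHopfAlgebra.IsLeftIntegral k (integral D Λ) := by
  refine lin_ext (k := k) (by fun_prop) ?_ fun a ℓ b => ?_
  · unfold WeakHopfAlgebra.targetCounital
    simp only [comul_eq, counit_eq]
    fun_prop
  · rw [tm_mul_integral D hΛ, ← target_tm]
    rfl

end QTG

/-! ### Non-degeneracy of the integral. -/

namespace QTG

open Sweedler

variable {k L B : Type*} [Field k] [Ring L] [HopfAlgebra k L] [Ring B] [Algebra k B]
  (D : TransformationDatum k L B) [FiniteDimensional k B]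

/-- `Δ(Λ̄) = ((e¹ ◁ Λ₁) ⊗ S(Λ₄) ⊗ f¹) ⊗ ((f² ◁ Λ₃) ⊗ S(Λ₂) ⊗ e²)` for `Λ̄ = integral D Λ`. -/
theorem comulMap_integral (Λ : L) : comulMap D (integral D Λ) =
    sweedler (fun e₁ e₂ => sweedler (fun u w => sweedler (fun p q => sweedler (fun r s =>
      sweedler (fun f₁ f₂ => tm D (D.act e₁ u) (antipode k q) f₁ ⊗ₜ[k]
        tm D (D.act f₂ s) (antipode k r) e₂) D.e) (comul (R := k) p)) (comul (R := k) w))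
        (comul (R := k) Λ)) D.e := by
  simp only [integral, lm_sweedler, comulMap_tm]
  -- The comultiplication of S(Λ₂) makes f² carry a double antipode, which acts trivially.
  simp (disch := fun_prop) only [sw_antipode, D.act_antipode_antipode]

/-- The linear map `a ⊗ ℓ ⊗ b ↦ ω(ay) ω((b ◁ S(ℓ₂))x) ℓ₁`. -/
noncomputable def contraction (x y : B) : QTG D →ₗ[k] L :=
  lift3 D (fun a ℓ b => sweedler (fun ℓ₁ ℓ₂ => D.traceForm (a * y) •
    D.traceForm (D.act b (antipode k ℓ₂) * x) • ℓ₁) (comul (R := k) ℓ))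
    (by fun_prop) (by fun_prop) (by fun_prop)

theorem contraction_tm (x y a b : B) (ℓ : L) : contraction D x y (tm D a ℓ b) =
    sweedler (fun ℓ₁ ℓ₂ => D.traceForm (a * y) •
    D.traceForm (D.act b (antipode k ℓ₂) * x) • ℓ₁) (comul (R := k) ℓ) := by
  rw [contraction, lift3_tm]

variable [FiniteDimensional k L]

/-- The contraction is built so that both copies of `e` in Δ(Λ̄) are evaluated by ω: the copy f puts
x in the first slot of φ, and the copy e puts y ◁ S(Λ₁) in the third. The action of S(ℓ₂) in its
definition is there to cancel Λ₃ acting on f². What is left is ψ(Λ₁)Λ₂ inside an antipode, for a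
functional ψ on `L`. -/
theorem contraction_integralMap (Λ : L) (φ : Module.Dual k (QTG D)) (x y : B) :
    contraction D x y (WeakHopfAlgebra.integralMap k (integral D Λ) φ) =
      antipode k (sweedler (fun u z => sweedler (fun p r =>
        φ (tm D x (antipode k r) (D.act y (antipode k p)))) (comul (R := k) u) • z)
        (comul (R := k) Λ)) := by
  have e1 : contraction D x y (WeakHopfAlgebra.integralMap k (integral D Λ) φ) =
      sweedler (fun e₁ e₂ => sweedler (fun u w => sweedler (fun p q => sweedler (fun r s =>
      sweedler (fun f₁ f₂ => φ (tm D (D.act f₂ s) (antipode k r) e₂) • sweedler (fun q₁ q₂ =>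
        D.traceForm (D.act e₁ u * y) • D.traceForm (D.act f₁ q₁ * x) • antipode k q₂)
        (comul (R := k) q)) D.e) (comul (R := k) p)) (comul (R := k) w))
        (comul (R := k) Λ)) D.e := by
    rw [WeakHopfAlgebra.integralMap, comul_eq, comulMap_integral]
    simp (disch := fun_prop) only [sweedler_sweedler, sweedler_tmul, lm_sweedler, map_smul,
      contraction_tm, sw_antipode, D.act_antipode_antipode]
  have e2 : ∀ (e₁ e₂ : B) (u w : L), sweedler (fun p q => sweedler (fun r s =>
      sweedler (fun f₁ f₂ => φ (tm D (D.act f₂ s) (antipode k r) e₂) • sweedler (fun q₁ q₂ =>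
        D.traceForm (D.act e₁ u * y) • D.traceForm (D.act f₁ q₁ * x) • antipode k q₂)
        (comul (R := k) q)) D.e) (comul (R := k) p)) (comul (R := k) w) =
      sweedler (fun r t => D.traceForm (D.act e₁ u * y) • φ (tm D x (antipode k r) e₂) •
        antipode k t) (comul (R := k) w) := by
    intro e₁ e₂ u w
    rw [sw_coassoc (by fun_prop) (by fun_prop) (by fun_prop)]
    congr 1; funext r v
    -- The contraction makes q₁ act on f¹; compatibility of `e` with the action moves it to f² as
    -- S(q₁), where it precedes the action of s.
    have e3 : ∀ s q, sweedler (fun f₁ f₂ => φ (tm D (D.act f₂ s) (antipode k r) e₂) •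
        sweedler (fun q₁ q₂ => D.traceForm (D.act e₁ u * y) • D.traceForm (D.act f₁ q₁ * x) •
          antipode k q₂) (comul (R := k) q)) D.e =
        sweedler (fun q₁ q₂ => sweedler (fun f₁ f₂ =>
          φ (tm D (D.act (D.act f₂ (antipode k q₁)) s) (antipode k r) e₂) •
          D.traceForm (D.act e₁ u * y) • D.traceForm (f₁ * x) • antipode k q₂) D.e)
          (comul (R := k) q) := by
      intro s q
      simp only [smul_sweedler]
      rw [sweedler_comm]
      congr 1; funext q₁ q₂
      exact D.sw_act_e (f := fun f₁ f₂ => φ (tm D (D.act f₂ s) (antipode k r) e₂) •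
          D.traceForm (D.act e₁ u * y) • D.traceForm (f₁ * x) • antipode k q₂)
          (by fun_prop) (by fun_prop) q₁
    simp only [e3]
    rw [← sw_coassoc (by fun_prop) (by fun_prop) (by fun_prop)]
    -- Now s and q₁ are consecutive components of Λ, so (f² ◁ S(q₁)) ◁ s collapses to a counit times
    -- f². The remaining ω(f¹x)f² is x.
    have e4 : ∀ t z : L, sweedler (fun s q₁ => sweedler (fun f₁ f₂ =>
        φ (tm D (D.act (D.act f₂ (antipode k q₁)) s) (antipode k r) e₂) •
        D.traceForm (D.act e₁ u * y) • D.traceForm (f₁ * x) • antipode k z) D.e)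
        (comul (R := k) t) = counit (R := k) t • sweedler (fun f₁ f₂ => D.traceForm (f₁ * x) •
          φ (tm D f₂ (antipode k r) e₂) • D.traceForm (D.act e₁ u * y) • antipode k z) D.e := by
      intro t z
      rw [sweedler_comm, smul_sweedler]
      congr 1; funext f₁ f₂
      rw [D.sw_act_antipode_mul_self (f := fun a => φ (tm D a (antipode k r) e₂) •
        D.traceForm (D.act e₁ u * y) • D.traceForm (f₁ * x) • antipode k z) (by fun_prop),
        smul_comm (D.traceForm (f₁ * x)), smul_comm (D.traceForm (f₁ * x))]
    simp only [e4]
    rw [sw_counit_l (f := fun z => sweedler (fun f₁ f₂ => D.traceForm (f₁ * x) •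
      φ (tm D f₂ (antipode k r) e₂) • D.traceForm (D.act e₁ u * y) • antipode k z) D.e)
      (by fun_prop), D.sw_trace_mul' (f := fun a => φ (tm D a (antipode k r) e₂) •
        D.traceForm (D.act e₁ u * y) • antipode k v) (by fun_prop), smul_comm]
  rw [e1]
  simp only [e2]
  rw [sweedler_comm]
  -- The action is adjoint to its antipode for ω, so ω((e¹ ◁ u)y)e² = ω(e¹(y ◁ S(u)))e² = y ◁ S(u).
  have e6 : ∀ u w : L, sweedler (fun e₁ e₂ => sweedler (fun r t =>
      D.traceForm (D.act e₁ u * y) • φ (tm D x (antipode k r) e₂) • antipode k t)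
      (comul (R := k) w)) D.e = sweedler (fun r t =>
        φ (tm D x (antipode k r) (D.act y (antipode k u))) • antipode k t)
        (comul (R := k) w) := by
    intro u w
    rw [sweedler_comm]
    congr 1; funext r t
    simp only [D.traceForm_act_mul]
    exact D.sw_trace_mul' (f := fun b => φ (tm D x (antipode k r) b) • antipode k t)
      (by fun_prop) _
  simp only [e6]
  rw [← sw_coassoc (by fun_prop) (by fun_prop) (by fun_prop)]
  simp only [lm_sweedler, sweedler_smul, map_smul]

/-- A functional killed by Ψ is tested against all contractions, which reduces the question to
non-degeneracy of Λ in `L`; a dimension count then upgrades injectivity to bijectivity. -/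
theorem isNondegenerate_integral {Λ : L} (hΛ : HopfIsRightIntegral k Λ) (h0 : Λ ≠ 0) :
    WeakHopfAlgebra.IsNondegenerate k (integral D Λ) := by
  let Ψ : Module.Dual k (QTG D) →ₗ[k] QTG D := IsLinearMap.mk'
    (WeakHopfAlgebra.integralMap k (integral D Λ))
    (lin_sweedler_f (fun u v => lin_smul_l (lin_app lin_id v) u) _)
  have hinj : Function.Injective Ψ := by
    rw [← LinearMap.ker_eq_bot, LinearMap.ker_eq_bot']
    intro φ hφ
    have h : ∀ (x y : B) (ℓ : L), sweedler (fun p r =>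
        φ (tm D x (antipode k r) (D.act y (antipode k p)))) (comul (R := k) ℓ) = 0 := by
      intro x y ℓ
      have h1 := contraction_integralMap D Λ φ x y
      rw [show WeakHopfAlgebra.integralMap k (integral D Λ) φ = 0 from hφ, map_zero] at h1
      have h2 := antipode_bijective.1 (h1.symm.trans (map_zero (antipode k : L →ₗ[k] L)).symm)
      exact LinearMap.congr_fun (rightIntegral_nondegenerate hΛ h0 (IsLinearMap.mk' (fun u : L =>
        sweedler (fun p r => φ (tm D x (antipode k r) (D.act y (antipode k p))))
          (comul (R := k) u)) (by fun_prop)) h2) ℓ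
    refine LinearMap.ext (lin_ext (by fun_prop) (by fun_prop) fun x m y => ?_)
    obtain ⟨ℓ, rfl⟩ := (antipode_bijective (k := k) (L := L)).2 m
    -- Inserting y = y ◁ ℓ₁S(ℓ₂) writes a general value of φ as a sum of the expressions annihilated
    -- by `h`, with y ◁ ℓ₁ in place of y. Surjectivity of S ensures that every middle leg has the
    -- form S(ℓ).
    have e : φ (tm D x (antipode k ℓ) y) = sweedler (fun p v => sweedler (fun q r =>
        φ (tm D x (antipode k r) (D.act (D.act y p) (antipode k q)))) (comul (R := k) v))
        (comul (R := k) ℓ) := by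
      rw [← sw_coassoc (by fun_prop) (by fun_prop) (by fun_prop)]
      simp only [D.act_act]
      have : ∀ u r : L, sweedler (fun p q => φ (tm D x (antipode k r)
          (D.act y (p * antipode k q)))) (comul (R := k) u) =
          counit (R := k) u • φ (tm D x (antipode k r) y) := by
        intro u r
        rw [sw_antipode_r (f := fun t => φ (tm D x (antipode k r) (D.act y t))) (by fun_prop),
          D.act_one]
      simp only [this]
      exact (sw_counit_l (f := fun r => φ (tm D x (antipode k r) y)) (by fun_prop) ℓ).symm
    rw [e]
    simp only [h]
    simp [sweedler]
  exact ⟨hinj, (LinearMap.injective_iff_surjective_of_finrank_eq_finrank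
    (Subspace.dual_finrank_eq (K := k) (V := QTG D))).1 hinj⟩

end QTG

theorem proposition5p7 {k L B : Type*} [Field k] [CharZero k]
    [Ring L] [HopfAlgebra k L] [FiniteDimensional k L]
    [Ring B] [Algebra k B] [FiniteDimensional k B]
    (D : TransformationDatum k L B) (Λ : L) (hΛ : HopfIsRightIntegral k Λ) :
    WeakHopfAlgebra.IsLeftIntegral k (QTG.integral D Λ) ∧
      (Λ ≠ 0 → WeakHopfAlgebra.IsNondegenerate k (QTG.integral D Λ)) :=
  ⟨QTG.isLeftIntegral_integral D hΛ, QTG.isNondegenerate_integral D hΛ⟩
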